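/- Let $L^2(\mathbb R)$ be the space of complex-valued square-integrable functions, and for $c>0$, $y\in\mathbb R$ let $D_cf(x)=c^{1/2}f(cx)$ and $T_yf(x)=f(x-y)$; the Fourier transform is the unitary extension of $\widehat f(\gamma)=\int f(x)e^{-2\pi i x\gamma}\,dx$. Let $a>1$, $b>0$, and let $\psi\in L^2(\mathbb R)$ be such that $\{D_{a^j}T_{kb}\psi\}_{j,k\in\mathbb Z}$ is a frame for $L^2(\mathbb R)$ with lower frame bound $A>0$. Assume that for some $C>0$, $\sigma>0$, $$|\widehat\psi(\gamma)|\le\frac{C}{1+|\gamma|^{1+\sigma}}\quad\text{for a.e. }\gamma\in\mathbb R .$$ For $K\in\mathbb N=\{1,2,\dots\}$ there is a unique odd integer $N$ with $N-2\le 2bK<N$. Let $\psi_K\in L^2(\mathbb R)$ be given by $\widehat{\psi_K}=\widehat\psi\,\chi_{[-K,K]}$, and put $$\varepsilon_K=\left(\frac{K+1/b}{K^{3+2\sigma}}\right)^{1/2}2C\left[\Big(1+\frac1{2\sigma}\Big)\frac{a^{1+\sigma}}{a^{1+\sigma}-1}\right]^{1/2}.$$ Then $\varepsilon_K\to0$ as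 $K\to\infty$. Moreover, for every $K\in\mathbb N$ with $\varepsilon_K<\sqrt{2bA}$ the following hold. For a.e. $\gamma$ the sum $\sum_{k\in\mathbb Z}|\widehat{\psi_K}(a^k\gamma)|^2$ is finite and positive, and $$\widehat{\widetilde{\psi_K}}(\gamma)=\frac{b\,\widehat{\psi_K}(\gamma)}{N\sum_{k\in\mathbb Z}|\widehat{\psi_K}(a^k\gamma)|^2}$$ defines a function $\widetilde{\psi_K}\in L^2(\mathbb R)$. The systems $\{D_{a^j}T_{kb/N}\psi\}_{j,k\in\mathbb Z}$ and $\{D_{a^j}T_{kb/N}\widetilde{\psi_K}\}_{j,k\in\mathbb Z}$ are Bessel sequences, and for all $f\in L^2(\mathbb R)$ (with an unconditionally convergent series) $$\Big\|f-\sum_{j,k\in\mathbb Z}\langle f,D_{a^j}T_{kb/N}\widetilde{\psi_K}\rangle D_{a^j}T_{kb/N}\psi\Big\|\le\frac{\varepsilon_K}{\sqrt{2bA}-\varepsilon_K}\,\|f\| .$$ In particular, if $\varepsilon_K/(\sqrt{2bA}-\varepsilon_K)<1$, the two systems are approximately dual frames, that is, both are Bessel sequences and for some $\varepsilon<1$ the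 norm on the left-hand side is at most $\varepsilon\|f\|$ for all $f\in L^2(\mathbb R)$. -/

import Mathlib

open MeasureTheory FourierTransform Filter Topology

noncomputable section

namespace WaveletFrames

/-- The complex Hilbert space `L²(ℝ)` (Lebesgue measure). Its Fourier transform `𝓕` is Mathlib's
unitary extension of `f ↦ (γ ↦ ∫ f(x) exp(-2πixγ) dx)`, with inverse `𝓕⁻`. -/
abbrev L2 : Type := Lp (α := ℝ) ℂ 2 (volume : Measure ℝ)

theorem memLp_dilate {c : ℝ} (hc : 0 < c) (f : L2) :
    MemLp (fun x : ℝ => ((Real.sqrt c : ℝ) : ℂ) * f (c * x)) 2 volume := by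
  have h1 : MemLp (f : ℝ → ℂ) 2 (Measure.map (fun x => c * x) volume) := by
    rw [Real.map_volume_mul_left hc.ne']
    exact (Lp.memLp f).smul_measure ENNReal.ofReal_ne_top
  exact (h1.comp_of_map (measurable_const_mul c).aemeasurable).const_mul _

/-- The scaling operator `(D_c f)(x) = c^{1/2} f(c x)`, `c > 0`. -/
def dilate {c : ℝ} (hc : 0 < c) (f : L2) : L2 := (memLp_dilate hc f).toLp _

/-- The translation operator `(T_y f)(x) = f(x - y)`. -/
def translate (y : ℝ) (f : L2) : L2 :=
  Lp.compMeasurePreserving (fun x : ℝ => x - y) (measurePreserving_sub_right volume y) f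

/-- The wavelet system `{D_{a^j} T_{kb} φ}`, indexed by `(j, k) ∈ ℤ × ℤ`. -/
def waveletSystem {a : ℝ} (ha : 0 < a) (b : ℝ) (φ : L2) (p : ℤ × ℤ) : L2 :=
  dilate (zpow_pos ha p.1) (translate (p.2 * b) φ)

/-- The family `g` is a Bessel sequence. Mathlib's inner product is conjugate-linear in the first
variable, so `⟨f, g i⟩` (linear in `f`) is `inner ℂ (g i) f`. -/
def IsBessel {ι : Type*} (g : ι → L2) : Prop :=
  ∃ B : ℝ, 0 < B ∧ ∀ f : L2, Summable (fun i => ‖inner ℂ (g i) f‖ ^ 2) ∧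
    ∑' i, ‖inner ℂ (g i) f‖ ^ 2 ≤ B * ‖f‖ ^ 2

/-- The family `g` is a frame, and `A` is a lower frame bound for it. -/
def IsFrameWithLowerBound {ι : Type*} (g : ι → L2) (A : ℝ) : Prop :=
  0 < A ∧ IsBessel g ∧ ∀ f : L2, A * ‖f‖ ^ 2 ≤ ∑' i, ‖inner ℂ (g i) f‖ ^ 2

/-- The terms `⟨f, g̃ i⟩ g i` of the mixed frame expansion of `f`. -/
def expansionTerm {ι : Type*} (g gt : ι → L2) (f : L2) (i : ι) : L2 :=
  (inner ℂ (gt i) f : ℂ) • g i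

/-- `g` and `g̃` are approximately dual frames: both are Bessel sequences, and for some `ε < 1`,
`‖f - ∑ ⟨f, g̃ i⟩ g i‖ ≤ ε ‖f‖` for all `f`. -/
def ApproximatelyDual {ι : Type*} (g gt : ι → L2) : Prop :=
  IsBessel g ∧ IsBessel gt ∧ ∃ ε : ℝ, ε < 1 ∧ ∀ f : L2,
    Summable (expansionTerm g gt f) ∧ ‖f - ∑' i, expansionTerm g gt f i‖ ≤ ε * ‖f‖

/-- The truncation `ψ_K`, whose Fourier transform is `ψ̂ · χ_{[-K, K]}`. -/
def truncation (ψ : L2) (K : ℝ) : L2 :=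
  𝓕⁻ (((Lp.memLp (𝓕 ψ : L2)).indicator (measurableSet_Icc (a := -K) (b := K))).toLp _ : L2)

/-- The sum `∑_{k ∈ ℤ} |φ̂(a^k γ)|²`. -/
def calderonSum (a : ℝ) (φ : L2) (γ : ℝ) : ℝ :=
  ∑' k : ℤ, ‖(𝓕 φ : L2) (a ^ k * γ)‖ ^ 2

/-- The function `γ ↦ b φ̂(γ) / (N ∑_{k ∈ ℤ} |φ̂(a^k γ)|²)`. -/
def dualSymbol (a b : ℝ) (N : ℤ) (φ : L2) (γ : ℝ) : ℂ :=
  (b : ℂ) * (𝓕 φ : L2) γ / ((N : ℂ) * (calderonSum a φ γ : ℂ))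

/-- The function whose Fourier transform is `dualSymbol a b N φ`, a function in `L²(ℝ)`. -/
def dualGenerator {a b : ℝ} {N : ℤ} {φ : L2} (h : MemLp (dualSymbol a b N φ) 2 volume) : L2 :=
  𝓕⁻ (h.toLp _ : L2)

/-- `N` is an odd integer with `N - 2 ≤ 2bK < N`. -/
def IsOversamplingFactor (b : ℝ) (K : ℕ) (N : ℤ) : Prop :=
  Odd N ∧ (N : ℝ) - 2 ≤ 2 * b * K ∧ 2 * b * K < N

/-- `ε_K = ((K + 1/b) / K^{3+2σ})^{1/2} · 2C · [(1 + 1/(2σ)) a^{1+σ} / (a^{1+σ} - 1)]^{1/2}`. -/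
def errorBound (a b C σ : ℝ) (K : ℕ) : ℝ :=
  Real.sqrt (((K : ℝ) + 1 / b) / (K : ℝ) ^ (3 + 2 * σ)) * (2 * C) *
    Real.sqrt ((1 + 1 / (2 * σ)) * (a ^ (1 + σ) / (a ^ (1 + σ) - 1)))

end WaveletFrames

end

/-!
On the Fourier side the coefficients of `f` with respect to `{D_{a^j} T_{kb} φ}` at the scale `j`
are the Fourier coefficients, for the period `1/b`, of `γ ↦ conj φ̂(γ) · a^{j/2} f̂(a^j γ)`
(`inner_waveletSystem`). Two estimates of their energy carry the proof.

* If this function lives on an interval of length `1/b`, Parseval's identity gives the exact value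
  `(1/b) ∫ |f̂(γ)|² |φ̂(a^{-j} γ)|² dγ` (`tsum_enorm_inner_scale_eq`).
* In general, periodization and the Cauchy–Schwarz inequality bound the energy by
  `(M/b) ∫ |f̂(γ)|² |φ̂(a^{-j} γ)| dγ`, where `M = sup_x ∑ₙ |φ̂(x + n/b)|`
  (`tsum_enorm_inner_scale_le`).

Testing the frame inequalities of `ψ` on functions whose Fourier transforms are indicators of small
sets turns them into `bA ≤ ∑ⱼ |ψ̂(a^j γ)|² ≤ bB` almost everywhere (`calderon_le`, `le_calderon`).
The first estimate is exact at fine scales. At coarse scales only the values of `ψ̂` far out enter,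
and the second estimate together with the decay of `ψ̂` shows that they do not contribute in the
limit.

Write `ψ = ψ_K + R`. Since `N/b > 2K`, the first estimate applies at every scale to `ψ_K` and to its
dual with step `b/N`, so the energy is governed by the Calderón sum of `ψ_K`, which lies between
`bA - ε_K²/2` and `bB` (`ae_symbolSum_truncated_bounds`). Polarizing Parseval's identity shows that
the systems of `ψ_K` and its dual reproduce every `f` exactly (`tsum_expansionTerm_eq_self`), and
the dual system has the Bessel bound `(b/N) / (bA - ε_K²/2)`. The second estimate shows that the
system of `R` has the Bessel bound `(N/b) ε_K²/2` (`BesselBound.of_tail`,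
`tail_bound_le_errorBound`). The error `f - ∑ ⟨f, g̃⟩ g` is minus the mixed expansion of `f` with
respect to the dual system and the system of `R`, so its norm is at most
`(ε_K² / (2bA - ε_K²))^{1/2} ‖f‖ ≤ ε_K / (√(2bA) - ε_K) ‖f‖`.
-/

noncomputable section

namespace WaveletFrames

/-! ### The coefficients of a wavelet system on the Fourier side -/

theorem quasiMeasurePreserving_mul_left {c : ℝ} (hc : c ≠ 0) :
    Measure.QuasiMeasurePreserving (fun x : ℝ => c * x) volume volume := by
  refine ⟨measurable_const_mul c, ?_⟩
  rw [Real.map_volume_mul_left hc]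
  exact Measure.smul_absolutelyContinuous

theorem ae_comp_mul_left {c : ℝ} (hc : c ≠ 0) {p : ℝ → Prop} (h : ∀ᵐ x : ℝ, p x) :
    ∀ᵐ x : ℝ, p (c * x) :=
  (quasiMeasurePreserving_mul_left hc).ae h

theorem coeFn_dilate {c : ℝ} (hc : 0 < c) (f : L2) :
    dilate hc f =ᵐ[volume] fun x => ((Real.sqrt c : ℝ) : ℂ) * f (c * x) :=
  MemLp.coeFn_toLp _

theorem coeFn_translate (y : ℝ) (f : L2) :
    translate y f =ᵐ[volume] fun x => f (x - y) :=
  Lp.coeFn_compMeasurePreserving f (measurePreserving_sub_right volume y)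

theorem inner_dilate_left {c : ℝ} (hc : 0 < c) (f g : L2) :
    inner ℂ (dilate hc f) g = inner ℂ f (dilate (inv_pos.2 hc) g) := by
  rw [L2.inner_def, L2.inner_def]
  have h1 : (fun x => inner ℂ (dilate hc f x) (g x)) =ᵐ[volume]
      fun x => (fun y => inner ℂ (((Real.sqrt c : ℝ) : ℂ) * f y) (g (c⁻¹ * y))) (c * x) := by
    filter_upwards [coeFn_dilate hc f] with x hx
    rw [hx]
    simp only [inv_mul_cancel_left₀ hc.ne']
  rw [integral_congr_ae h1, Measure.integral_comp_mul_left
    (fun y => inner ℂ (((Real.sqrt c : ℝ) : ℂ) * f y) (g (c⁻¹ * y))), ← integral_smul]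
  refine integral_congr_ae ?_
  filter_upwards [coeFn_dilate (inv_pos.2 hc) g] with x hx
  have hs : (Real.sqrt c : ℝ) ≠ 0 := (Real.sqrt_pos.2 hc).ne'
  have hs2 : |c⁻¹| = (Real.sqrt c)⁻¹ * (Real.sqrt c)⁻¹ := by
    rw [abs_of_pos (inv_pos.2 hc), ← mul_inv, Real.mul_self_sqrt hc.le]
  have hs3 : ((Real.sqrt c : ℝ) : ℂ) ≠ 0 := by exact_mod_cast hs
  rw [hx, hs2]
  simp only [RCLike.inner_apply, map_mul, Complex.conj_ofReal, Real.sqrt_inv, Complex.real_smul,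
    Complex.ofReal_mul, Complex.ofReal_inv]
  field_simp

theorem fourier_dilate_schwartz {c : ℝ} (hc : 0 < c) (φ : SchwartzMap ℝ ℂ) :
    𝓕 (dilate hc (φ.toLp 2)) = dilate (inv_pos.2 hc) (𝓕 (φ.toLp 2 : L2)) := by
  set e : ℝ ≃L[ℝ] ℝ := ContinuousLinearEquiv.unitsEquivAut ℝ (Units.mk0 c hc.ne') with he
  set φ' : SchwartzMap ℝ ℂ :=
    ((Real.sqrt c : ℝ) : ℂ) • SchwartzMap.compCLMOfContinuousLinearEquiv ℂ e φ with hφ'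
  have hval : ∀ x, φ' x = ((Real.sqrt c : ℝ) : ℂ) * φ (c * x) := by
    intro x
    simp [hφ', he, mul_comm]
  have h1 : dilate hc (φ.toLp 2) = φ'.toLp 2 := by
    refine Lp.ext ?_
    filter_upwards [coeFn_dilate hc (φ.toLp 2), SchwartzMap.coeFn_toLp φ' 2 volume,
      ae_comp_mul_left hc.ne' (SchwartzMap.coeFn_toLp φ 2 volume)] with x h1 h2 h3
    rw [h1, h2, h3, hval]
  rw [h1, SchwartzMap.toLp_fourier_eq, SchwartzMap.toLp_fourier_eq]
  refine Lp.ext ?_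
  filter_upwards [coeFn_dilate (inv_pos.2 hc) ((𝓕 φ).toLp 2),
    SchwartzMap.coeFn_toLp (𝓕 φ') 2 volume,
    ae_comp_mul_left (inv_pos.2 hc).ne' (SchwartzMap.coeFn_toLp (𝓕 φ) 2 volume)] with x h1 h2 h3
  rw [h1, h2, h3, SchwartzMap.fourier_coe, SchwartzMap.fourier_coe,
    Real.fourier_real_eq_integral_exp_smul, Real.fourier_real_eq_integral_exp_smul]
  have h4 : ∀ v : ℝ, Complex.exp (((-2 * Real.pi * v * x : ℝ) : ℂ) * Complex.I) • φ' v =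
      (fun y : ℝ => ((Real.sqrt c : ℝ) : ℂ) *
        (Complex.exp (((-2 * Real.pi * y * (c⁻¹ * x) : ℝ) : ℂ) * Complex.I) • φ y)) (c * v) := by
    intro v
    have : -2 * Real.pi * (c * v) * (c⁻¹ * x) = -2 * Real.pi * v * x := by
      field_simp
    simp only [this, hval, smul_eq_mul]
    ring
  simp_rw [h4]
  rw [Measure.integral_comp_mul_left (fun y : ℝ => ((Real.sqrt c : ℝ) : ℂ) *
        (Complex.exp (((-2 * Real.pi * y * (c⁻¹ * x) : ℝ) : ℂ) * Complex.I) • φ y)),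
    integral_const_mul]
  have hs2 : |c⁻¹| = (Real.sqrt c)⁻¹ * (Real.sqrt c)⁻¹ := by
    rw [abs_of_pos (inv_pos.2 hc), ← mul_inv, Real.mul_self_sqrt hc.le]
  have hs3 : ((Real.sqrt c : ℝ) : ℂ) ≠ 0 := by exact_mod_cast (Real.sqrt_pos.2 hc).ne'
  rw [hs2, Complex.real_smul, Real.sqrt_inv, ← mul_assoc]
  congr 1
  push_cast
  field_simp

/-- The Fourier transform intertwines `D_c` with `D_{1/c}`. -/
theorem fourier_dilate {c : ℝ} (hc : 0 < c) (f : L2) :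
    𝓕 (dilate hc f) = dilate (inv_pos.2 hc) (𝓕 f) := by
  -- By duality it suffices to test against `𝓕 φ`, and by density `φ` may be taken Schwartz.
  have key : ∀ φ : L2, inner ℂ φ (dilate hc f) =
      inner ℂ (𝓕 φ) (dilate (inv_pos.2 hc) (𝓕 f)) := by
    intro φ
    refine DenseRange.induction_on
      (p := fun φ : L2 => inner ℂ φ (dilate hc f) = inner ℂ (𝓕 φ) (dilate (inv_pos.2 hc) (𝓕 f)))
      (SchwartzMap.denseRange_toLpCLM (E := ℝ) (F := ℂ) (p := 2) (μ := volume)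
        ENNReal.ofNat_ne_top) φ ?_ ?_
    · refine isClosed_eq (by fun_prop) ?_
      exact (Lp.fourierTransformₗᵢ ℝ ℂ).continuous.inner continuous_const
    · intro φ
      have hd := inner_dilate_left (inv_pos.2 hc) (φ.toLp 2) f
      simp only [inv_inv] at hd
      have h2 := fourier_dilate_schwartz (inv_pos.2 hc) φ
      have h3 := inner_dilate_left hc (𝓕 (φ.toLp 2 : L2)) (𝓕 f)
      simp only [inv_inv] at h2
      rw [← h2, Lp.inner_fourier_eq, hd] at h3
      exact h3
  refine ext_inner_left ℂ fun v => ?_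
  have := key (𝓕⁻ v)
  rw [FourierTransform.fourier_fourierInv_eq] at this
  rw [← this, ← Lp.inner_fourier_eq (𝓕⁻ v), FourierTransform.fourier_fourierInv_eq]

theorem memLp_modulate (y : ℝ) (f : L2) :
    MemLp (fun γ : ℝ => Complex.exp (((2 * Real.pi * y * γ : ℝ) : ℂ) * Complex.I) * f γ) 2
      volume := by
  have hc : Continuous fun γ : ℝ => Complex.exp (((2 * Real.pi * y * γ : ℝ) : ℂ) * Complex.I) := by
    fun_prop
  refine (Lp.memLp f).of_le (hc.aestronglyMeasurable.mul (Lp.aestronglyMeasurable f))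
    (ae_of_all _ fun x => ?_)
  rw [norm_mul, Complex.norm_exp_ofReal_mul_I, one_mul]

/-- `T_y` acts on the Fourier side as multiplication by a character. -/
theorem inner_translate (y : ℝ) (φ f : L2) :
    inner ℂ (translate y φ) f = ∫ γ : ℝ, (starRingEnd ℂ) ((𝓕 φ : L2) γ) * (𝓕 f : L2) γ *
      Complex.exp (((2 * Real.pi * y * γ : ℝ) : ℂ) * Complex.I) := by
  have h0 : ∀ φ : L2, (∫ γ : ℝ, (starRingEnd ℂ) ((𝓕 φ : L2) γ) * (𝓕 f : L2) γ *
      Complex.exp (((2 * Real.pi * y * γ : ℝ) : ℂ) * Complex.I)) =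
      inner ℂ (𝓕 φ) ((memLp_modulate y (𝓕 f)).toLp _) := by
    intro φ
    rw [L2.inner_def]
    refine integral_congr_ae ?_
    filter_upwards [(memLp_modulate y (𝓕 f)).coeFn_toLp] with x hx
    rw [hx, RCLike.inner_apply]
    ring
  rw [h0]
  refine DenseRange.induction_on
    (p := fun φ : L2 => inner ℂ (translate y φ) f =
      inner ℂ (𝓕 φ) ((memLp_modulate y (𝓕 f)).toLp _))
    (SchwartzMap.denseRange_toLpCLM (E := ℝ) (F := ℂ) (p := 2) (μ := volume)
      ENNReal.ofNat_ne_top) φ ?_ ?_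
  · refine isClosed_eq ?_ ?_
    · exact ((Lp.compMeasurePreservingₗᵢ ℂ (fun x : ℝ => x - y)
        (measurePreserving_sub_right volume y)).continuous).inner continuous_const
    · exact (Lp.fourierTransformₗᵢ ℝ ℂ).continuous.inner continuous_const
  · intro φ
    change inner ℂ (translate y (φ.toLp 2)) f = inner ℂ (𝓕 (φ.toLp 2 : L2)) _
    rw [← h0, ← Lp.inner_fourier_eq]
    have h1 : translate y (φ.toLp 2) = (φ.compSubConstCLM ℂ y).toLp 2 := by
      refine Lp.ext ?_
      filter_upwards [coeFn_translate y (φ.toLp 2),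
        SchwartzMap.coeFn_toLp (φ.compSubConstCLM ℂ y) 2 volume,
        (measurePreserving_sub_right volume y).quasiMeasurePreserving.ae
          (SchwartzMap.coeFn_toLp φ 2 volume)] with x h1 h2 h3
      rw [h1, h2, h3, SchwartzMap.compSubConstCLM_apply]
    rw [h1, SchwartzMap.toLp_fourier_eq, SchwartzMap.toLp_fourier_eq, L2.inner_def]
    refine integral_congr_ae ?_
    filter_upwards [SchwartzMap.coeFn_toLp (𝓕 φ) 2 volume,
      SchwartzMap.coeFn_toLp (𝓕 (φ.compSubConstCLM ℂ y)) 2 volume] with x h1 h2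
    rw [h1, h2, RCLike.inner_apply, SchwartzMap.fourier_coe, SchwartzMap.fourier_coe,
      Real.fourier_real_eq_integral_exp_smul, Real.fourier_real_eq_integral_exp_smul]
    have h4 : ∀ v : ℝ, Complex.exp (((-2 * Real.pi * v * x : ℝ) : ℂ) * Complex.I) •
        (φ.compSubConstCLM ℂ y) v =
        (fun s : ℝ => Complex.exp (((-2 * Real.pi * y * x : ℝ) : ℂ) * Complex.I) *
        (Complex.exp (((-2 * Real.pi * s * x : ℝ) : ℂ) * Complex.I) • φ s)) (v - y) := by
      intro v
      simp only [SchwartzMap.compSubConstCLM_apply, smul_eq_mul]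
      rw [← mul_assoc, ← Complex.exp_add]
      congr 2
      push_cast
      ring
    simp_rw [h4]
    rw [integral_sub_right_eq_self (fun s : ℝ =>
      Complex.exp (((-2 * Real.pi * y * x : ℝ) : ℂ) * Complex.I) *
        (Complex.exp (((-2 * Real.pi * s * x : ℝ) : ℂ) * Complex.I) • φ s)), integral_const_mul,
      map_mul, ← Complex.exp_conj, map_mul, Complex.conj_ofReal, Complex.conj_I]
    have h5 : ((-2 * Real.pi * y * x : ℝ) : ℂ) * -Complex.I =
      ((2 * Real.pi * y * x : ℝ) : ℂ) * Complex.I := by push_cast; ring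
    rw [h5]
    ring

/-- The wavelet coefficients of `f` at scale `j` are the Fourier coefficients of the function
`γ ↦ conj φ̂(γ) · a^{j/2} f̂(a^j γ)`; here `u` and `v` represent `φ̂` and `f̂`. -/
theorem inner_waveletSystem {a : ℝ} (ha : 0 < a) (b : ℝ) (φ f : L2) {u v : ℝ → ℂ}
    (hu : (𝓕 φ : L2) =ᵐ[volume] u) (hv : (𝓕 f : L2) =ᵐ[volume] v) (p : ℤ × ℤ) :
    inner ℂ (waveletSystem ha b φ p) f =
      ∫ γ : ℝ, (starRingEnd ℂ) (u γ) * (((Real.sqrt (a ^ p.1) : ℝ) : ℂ) * v (a ^ p.1 * γ)) *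
        Complex.exp (((2 * Real.pi * (p.2 * b) * γ : ℝ) : ℂ) * Complex.I) := by
  have hj := zpow_pos ha p.1
  rw [waveletSystem, inner_dilate_left, inner_translate]
  refine integral_congr_ae ?_
  have h1 := fourier_dilate (inv_pos.2 hj) f
  simp only [inv_inv] at h1
  rw [h1]
  filter_upwards [hu, coeFn_dilate hj (𝓕 f), ae_comp_mul_left hj.ne' hv] with x hx1 hx2 hx3
  rw [hx1, hx2, hx3]

/-! ### Exponential sums: Parseval's identity and a weighted Bessel inequality -/

/-- The exponential `γ ↦ e^{2πikbγ}`, of period `1/b`. -/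
def expChar (b : ℝ) (k : ℤ) (γ : ℝ) : ℂ :=
  Complex.exp (((2 * Real.pi * (k * b) * γ : ℝ) : ℂ) * Complex.I)

theorem norm_expChar (b : ℝ) (k : ℤ) (γ : ℝ) : ‖expChar b k γ‖ = 1 :=
  Complex.norm_exp_ofReal_mul_I _

theorem continuous_expChar (b : ℝ) (k : ℤ) : Continuous (expChar b k) := by
  unfold expChar
  fun_prop

theorem expChar_add_period {b : ℝ} (hb : 0 < b) (k n : ℤ) (γ : ℝ) :
    expChar b k (γ + n * (1 / b)) = expChar b k γ := by
  have : (((2 * Real.pi * (k * b) * (γ + n * (1 / b)) : ℝ) : ℂ) * Complex.I) =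
      ((2 * Real.pi * (k * b) * γ : ℝ) : ℂ) * Complex.I +
        ((k * n : ℤ) : ℂ) * (2 * Real.pi * Complex.I) := by
    have hb' : (b : ℂ) ≠ 0 := by exact_mod_cast hb.ne'
    push_cast
    field_simp
  rw [expChar, this, Complex.exp_add, Complex.exp_int_mul_two_pi_mul_I, mul_one, expChar]

/-- Parseval's identity on an interval of length `1/b`. -/
theorem hasSum_sq_setIntegral_expChar {b : ℝ} (hb : 0 < b) (t : ℝ) {w : ℝ → ℂ}
    (hw : MemLp w 2 (volume.restrict (Set.Ioc t (t + 1 / b)))) :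
    HasSum (fun k : ℤ => ‖∫ γ in Set.Ioc t (t + 1 / b), w γ * expChar b k γ‖ ^ 2)
      ((1 / b) * ∫ γ in Set.Ioc t (t + 1 / b), ‖w γ‖ ^ 2) := by
  have hlt : t < t + 1 / b := by linarith [one_div_pos.2 hb]
  have h := hasSum_sq_fourierCoeffOn hlt hw
  rw [← (Equiv.neg ℤ).hasSum_iff] at h
  have h2 := h.mul_left ((1 / b) ^ 2)
  rw [intervalIntegral.integral_of_le hlt.le, add_sub_cancel_left, smul_eq_mul] at h2
  convert! h2 using 1
  · funext k
    rw [Function.comp_apply, fourierCoeffOn_eq_integral, intervalIntegral.integral_of_le hlt.le,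
      norm_smul, mul_pow, ← mul_assoc, Real.norm_eq_abs, sq_abs, ← mul_pow, add_sub_cancel_left,
      mul_one_div_cancel (one_div_pos.2 hb).ne', one_pow, one_mul]
    congr 2
    refine integral_congr_ae (ae_of_all _ fun x => ?_)
    simp only [Equiv.neg_apply, neg_neg, smul_eq_mul, fourier_coe_apply]
    rw [mul_comm, expChar]
    congr 2
    have hb' : (b : ℂ) ≠ 0 := by exact_mod_cast hb.ne'
    push_cast
    field_simp
  · field_simp

theorem hasSum_sq_integral_expChar {b : ℝ} (hb : 0 < b) (t : ℝ) {w : ℝ → ℂ}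
    (hw : MemLp w 2 volume) (hsupp : ∀ x, x ∉ Set.Ioc t (t + 1 / b) → w x = 0) :
    HasSum (fun k : ℤ => ‖∫ γ, w γ * expChar b k γ‖ ^ 2) ((1 / b) * ∫ γ, ‖w γ‖ ^ 2) := by
  have h := hasSum_sq_setIntegral_expChar hb t (hw.restrict _)
  rw [setIntegral_eq_integral_of_forall_compl_eq_zero (fun x hx => by simp [hsupp x hx])] at h
  convert h using 3 with k
  rw [setIntegral_eq_integral_of_forall_compl_eq_zero (fun x hx => by simp [hsupp x hx])]

theorem lintegral_enorm_sq_of_memLp {μ : Measure ℝ} {w : ℝ → ℂ} (hw : MemLp w 2 μ) :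
    ∫⁻ x, ‖w x‖ₑ ^ 2 ∂μ = ENNReal.ofReal (∫ x, ‖w x‖ ^ 2 ∂μ) := by
  rw [ofReal_integral_eq_lintegral_ofReal ((memLp_two_iff_integrable_sq_norm hw.1).1 hw)
    (ae_of_all _ fun _ => by positivity)]
  refine lintegral_congr fun x => ?_
  rw [ENNReal.ofReal_pow (norm_nonneg _), ofReal_norm]

theorem tsum_enorm_sq_eq_ofReal {ι : Type*} {f : ι → ℂ} {s : ℝ}
    (h : HasSum (fun i => ‖f i‖ ^ 2) s) : ∑' i, ‖f i‖ₑ ^ 2 = ENNReal.ofReal s := by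
  rw [← h.tsum_eq, ENNReal.ofReal_tsum_of_nonneg (fun _ => by positivity) h.summable]
  refine tsum_congr fun i => ?_
  rw [ENNReal.ofReal_pow (norm_nonneg _), ofReal_norm]

theorem tsum_enorm_sq_setIntegral_expChar {b : ℝ} (hb : 0 < b) (t : ℝ) {w : ℝ → ℂ}
    (hw : MemLp w 2 (volume.restrict (Set.Ioc t (t + 1 / b)))) :
    ∑' k : ℤ, ‖∫ γ in Set.Ioc t (t + 1 / b), w γ * expChar b k γ‖ₑ ^ 2 =
      ENNReal.ofReal (1 / b) * ∫⁻ γ in Set.Ioc t (t + 1 / b), ‖w γ‖ₑ ^ 2 := by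
  rw [tsum_enorm_sq_eq_ofReal (hasSum_sq_setIntegral_expChar hb t hw),
    ENNReal.ofReal_mul (by positivity), lintegral_enorm_sq_of_memLp hw]

theorem tsum_enorm_sq_integral_expChar {b : ℝ} (hb : 0 < b) (t : ℝ) {w : ℝ → ℂ}
    (hw : MemLp w 2 volume) (hsupp : ∀ x, x ∉ Set.Ioc t (t + 1 / b) → w x = 0) :
    ∑' k : ℤ, ‖∫ γ, w γ * expChar b k γ‖ₑ ^ 2 =
      ENNReal.ofReal (1 / b) * ∫⁻ γ, ‖w γ‖ₑ ^ 2 := by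
  rw [tsum_enorm_sq_eq_ofReal (hasSum_sq_integral_expChar hb t hw hsupp),
    ENNReal.ofReal_mul (by positivity), lintegral_enorm_sq_of_memLp hw]

/-- Polarized form of Parseval's identity, for two functions supported in a common interval of
length `1/b`. -/
theorem hasSum_inner_integral_expChar {b : ℝ} (hb : 0 < b) (t : ℝ) {w z : ℝ → ℂ}
    (hw : MemLp w 2 volume) (hz : MemLp z 2 volume)
    (hw0 : ∀ x, x ∉ Set.Ioc t (t + 1 / b) → w x = 0)
    (hz0 : ∀ x, x ∉ Set.Ioc t (t + 1 / b) → z x = 0) :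
    HasSum (fun k : ℤ => inner ℂ (∫ γ, w γ * expChar b k γ) (∫ γ, z γ * expChar b k γ))
      (((1 / b : ℝ) : ℂ) * ∫ γ, inner ℂ (w γ) (z γ)) := by
  have hres : ∀ {f : ℝ → ℂ}, MemLp f 2 volume → (∀ x, x ∉ Set.Ioc t (t + 1 / b) → f x = 0) →
      ∀ k, Integrable (fun γ => f γ * expChar b k γ) := by
    intro f hf hf0 k
    have h1 : Integrable f := by
      have : IntegrableOn f (Set.Ioc t (t + 1 / b)) := (hf.restrict _).integrable one_le_two
      exact (integrableOn_iff_integrable_of_support_subset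
        (fun x hx => by_contra fun h => hx (hf0 x h))).1 this
    exact h1.mul_bdd (c := 1) (continuous_expChar b k).aestronglyMeasurable
      (ae_of_all _ fun x => (norm_expChar b k x).le)
  have hz' : MemLp (fun x => Complex.I • z x) 2 volume :=
    hz.const_smul Complex.I
  have hz0' : ∀ x, x ∉ Set.Ioc t (t + 1 / b) → Complex.I • z x = 0 := fun x hx => by
    simp [hz0 x hx]
  have h1 := hasSum_sq_integral_expChar hb t (hw.add hz) (fun x hx => by simp [hw0 x hx, hz0 x hx])
  have h2 := hasSum_sq_integral_expChar hb t (hw.sub hz) (fun x hx => by simp [hw0 x hx, hz0 x hx])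
  have h3 := hasSum_sq_integral_expChar hb t (hw.sub hz')
    (fun x hx => by simp [hw0 x hx, hz0 x hx])
  have h4 := hasSum_sq_integral_expChar hb t (hw.add hz')
    (fun x hx => by simp [hw0 x hx, hz0 x hx])
  have e1 := Complex.hasSum_ofReal.2 h1
  have e2 := Complex.hasSum_ofReal.2 h2
  have e3 := Complex.hasSum_ofReal.2 h3
  have e4 := Complex.hasSum_ofReal.2 h4
  have e := ((e1.sub e2).add ((e3.sub e4).mul_right Complex.I)).div_const 4
  convert! e using 1
  · funext k
    have i1 := hres hw hw0 k
    have i2 := hres hz hz0 k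
    have i3 := hres hz' hz0' k
    have hI : ∫ γ, Complex.I • z γ * expChar b k γ = Complex.I • ∫ γ, z γ * expChar b k γ := by
      rw [← integral_smul]
      simp only [smul_mul_assoc]
    rw [inner_eq_sum_norm_sq_div_four]
    simp only [Pi.add_apply, Pi.sub_apply, add_mul, sub_mul]
    rw [integral_add i1 i2, integral_sub i1 i2, integral_sub i1 i3, integral_add i1 i3, hI]
    simp
  · have n1 := (memLp_two_iff_integrable_sq_norm (hw.add hz).1).1 (hw.add hz)
    have n2 := (memLp_two_iff_integrable_sq_norm (hw.sub hz).1).1 (hw.sub hz)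
    have n3 := (memLp_two_iff_integrable_sq_norm (hw.sub hz').1).1 (hw.sub hz')
    have n4 := (memLp_two_iff_integrable_sq_norm (hw.add hz').1).1 (hw.add hz')
    have m1 := Integrable.ofReal (𝕜 := ℂ) n1
    have m2 := Integrable.ofReal (𝕜 := ℂ) n2
    have m3 := Integrable.ofReal (𝕜 := ℂ) n3
    have m4 := Integrable.ofReal (𝕜 := ℂ) n4
    have : ∀ x, inner ℂ (w x) (z x) = (((‖(w + z) x‖ ^ 2 : ℝ) : ℂ) - ((‖(w - z) x‖ ^ 2 : ℝ) : ℂ) +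
        (((‖(w - fun x => Complex.I • z x) x‖ ^ 2 : ℝ) : ℂ) -
        ((‖(w + fun x => Complex.I • z x) x‖ ^ 2 : ℝ) : ℂ)) * Complex.I) / 4 := by
      intro x
      rw [inner_eq_sum_norm_sq_div_four]
      simp
    simp_rw [this]
    rw [integral_div, integral_add, integral_sub, integral_mul_const, integral_sub]
    · simp only [integral_complex_ofReal]
      push_cast
      ring
    · exact m3
    · exact m4
    · exact m1
    · exact m2
    · exact m1.sub m2
    · exact (m3.sub m4).mul_const _

theorem lintegral_eq_tsum_translates {T : ℝ} (hT : 0 < T) (f : ℝ → ENNReal) :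
    ∫⁻ x, f x = ∑' n : ℤ, ∫⁻ x in Set.Ioc 0 T, f (x + n * T) := by
  have hu := iUnion_Ioc_zsmul hT
  have hd := Set.pairwise_disjoint_Ioc_zsmul T
  rw [← setLIntegral_univ, ← hu, lintegral_iUnion (fun _ => measurableSet_Ioc) hd]
  refine tsum_congr fun n => ?_
  rw [← (measurePreserving_add_right volume ((n : ℝ) * T)).setLIntegral_comp_preimage_emb
    (measurableEmbedding_addRight _) f]
  congr 2
  ext x
  simp only [Set.mem_preimage, Set.mem_Ioc, zsmul_eq_mul]
  push_cast
  constructor <;> rintro ⟨h1, h2⟩ <;> constructor <;> linarith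

theorem hasSum_integral_translates {T : ℝ} (hT : 0 < T) {f : ℝ → ℂ} (hf : Integrable f) :
    HasSum (fun n : ℤ => ∫ x in Set.Ioc 0 T, f (x + n * T)) (∫ x, f x) := by
  have hu := iUnion_Ioc_zsmul hT
  have hd := Set.pairwise_disjoint_Ioc_zsmul T
  have h := hasSum_integral_iUnion (fun _ => measurableSet_Ioc) hd (hf.integrableOn (μ := volume))
  rw [hu, setIntegral_univ] at h
  convert! h using 2 with n
  rw [← (measurePreserving_add_right volume ((n : ℝ) * T)).setIntegral_preimage_emb
    (measurableEmbedding_addRight _) f]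
  congr 2
  ext x
  simp only [Set.mem_preimage, Set.mem_Ioc, zsmul_eq_mul]
  push_cast
  constructor <;> rintro ⟨h1, h2⟩ <;> constructor <;> linarith

/-- Cauchy–Schwarz for series of extended nonnegative reals, with weight `‖u i‖`. -/
theorem sq_tsum_enorm_mul_le {ι : Type*} (u V : ι → ℂ) :
    (∑' i, ‖u i * V i‖ₑ) ^ 2 ≤ (∑' i, ‖u i‖ₑ) * ∑' i, ‖u i‖ₑ * ‖V i‖ₑ ^ 2 := by
  have h : Tendsto (fun s : Finset ι => (∑ i ∈ s, ‖u i * V i‖ₑ) ^ 2) atTop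
      (𝓝 ((∑' i, ‖u i * V i‖ₑ) ^ 2)) :=
    ENNReal.Tendsto.pow ENNReal.summable.hasSum
  refine le_of_tendsto' h fun s => ?_
  refine le_trans ?_ (mul_le_mul' (ENNReal.sum_le_tsum s) (ENNReal.sum_le_tsum s))
  have := Finset.sum_sq_le_sum_mul_sum_of_sq_le_mul s (r := fun i => ‖u i * V i‖₊)
    (f := fun i => ‖u i‖₊) (g := fun i => ‖u i‖₊ * ‖V i‖₊ ^ 2) (fun _ _ => by positivity)
    (fun _ _ => by positivity) (fun i _ => le_of_eq (by simp only [nnnorm_mul]; ring))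
  simp only [enorm_eq_nnnorm]
  exact_mod_cast this

/-- A Bessel inequality for exponentials: the integrals over the line are Fourier coefficients of
the `1/b`-periodization of `u V`, which is estimated with the Cauchy–Schwarz inequality. -/
theorem tsum_enorm_sq_integral_expChar_le {b : ℝ} (hb : 0 < b) {u V : ℝ → ℂ} (hu : Measurable u)
    (hV : Measurable V) {M : ENNReal} (hM : M ≠ ⊤) (hint : Integrable fun x => u x * V x)
    (hfin : ∫⁻ x, ‖u x‖ₑ * ‖V x‖ₑ ^ 2 ≠ ⊤)
    (hsum : ∀ x, ∑' n : ℤ, ‖u (x + n * (1 / b))‖ₑ ≤ M) :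
    ∑' k : ℤ, ‖∫ γ, u γ * V γ * expChar b k γ‖ₑ ^ 2 ≤
      ENNReal.ofReal (1 / b) * (M * ∫⁻ x, ‖u x‖ₑ * ‖V x‖ₑ ^ 2) := by
  have hT : 0 < 1 / b := one_div_pos.2 hb
  set T := 1 / b with hTdef
  set H : ℝ → ℂ := fun x => ∑' n : ℤ, u (x + n * T) * V (x + n * T) with hH
  have hmeas : ∀ n : ℤ, Measurable fun x : ℝ => u (x + n * T) * V (x + n * T) := fun n =>
    (hu.comp (measurable_add_const _)).mul (hV.comp (measurable_add_const _))
  have hHm : Measurable H := Measurable.tsum hmeas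
  have hle : ∀ x, ‖H x‖ₑ ^ 2 ≤ M * ∑' n : ℤ, ‖u (x + n * T)‖ₑ * ‖V (x + n * T)‖ₑ ^ 2 := by
    intro x
    calc ‖H x‖ₑ ^ 2 ≤ (∑' n : ℤ, ‖u (x + n * T) * V (x + n * T)‖ₑ) ^ 2 := by
          gcongr
          exact enorm_tsum_le_tsum_enorm
      _ ≤ _ := sq_tsum_enorm_mul_le _ _
      _ ≤ _ := by gcongr; exact hsum x
  have hbound : ∫⁻ x in Set.Ioc 0 T, ‖H x‖ₑ ^ 2 ≤ M * ∫⁻ x, ‖u x‖ₑ * ‖V x‖ₑ ^ 2 := by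
    refine (lintegral_mono hle).trans ?_
    rw [lintegral_const_mul' _ _ hM, lintegral_eq_tsum_translates hT, lintegral_tsum]
    intro n
    exact ((hu.comp (measurable_add_const _)).enorm.mul
      ((hV.comp (measurable_add_const _)).enorm.pow_const 2)).aemeasurable
  have hHL : MemLp H 2 (volume.restrict (Set.Ioc 0 T)) := by
    refine ⟨hHm.aestronglyMeasurable, ?_⟩
    rw [eLpNorm_lt_top_iff_lintegral_rpow_enorm_lt_top (by simp) (by simp)]
    simp only [ENNReal.toReal_ofNat, ENNReal.rpow_ofNat]
    exact hbound.trans_lt (ENNReal.mul_lt_top hM.lt_top hfin.lt_top)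
  have hcoef : ∀ k : ℤ, ∫ γ, u γ * V γ * expChar b k γ =
      ∫ γ in Set.Ioc 0 (0 + T), H γ * expChar b k γ := by
    intro k
    have hint' : Integrable fun γ => u γ * V γ * expChar b k γ :=
      hint.mul_bdd (c := 1) (continuous_expChar b k).aestronglyMeasurable
        (ae_of_all _ fun x => (norm_expChar b k x).le)
    rw [← (hasSum_integral_translates hT hint').tsum_eq, zero_add, hH]
    simp_rw [← tsum_mul_right, hTdef, expChar_add_period hb]
    rw [integral_tsum]
    · intro n
      exact ((hmeas n).mul (continuous_expChar b k).measurable).aestronglyMeasurable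
    · have := hint.2
      rw [HasFiniteIntegral, lintegral_eq_tsum_translates hT] at this
      refine ne_of_lt (lt_of_le_of_lt (le_of_eq ?_) this)
      refine tsum_congr fun n => lintegral_congr fun x => ?_
      rw [enorm_mul, ← ofReal_norm (expChar b k x), norm_expChar]
      simp [hTdef]
  simp_rw [hcoef]
  rw [tsum_enorm_sq_setIntegral_expChar hb 0 (by rwa [zero_add]), zero_add]
  gcongr

/-! ### Lattice and dilation sums of a decaying function -/

/-- Comparison of `y^{-(1+σ)}` with a telescoping difference. -/
theorem two_mul_rpow_le_sub {σ y : ℝ} (hσ : 0 < σ) (hy : 2 < y) :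
    2 * σ * y ^ (-(1 + σ)) ≤ (y - 2) ^ (-σ) - y ^ (-σ) := by
  have hy0 : 0 < y := by linarith
  have ht : 0 < 1 - 2 / y := by
    rw [sub_pos, div_lt_one hy0]
    exact hy
  have h1 : (y - 2) ^ (-σ) = y ^ (-σ) * (1 - 2 / y) ^ (-σ) := by
    rw [← Real.mul_rpow hy0.le ht.le]
    congr 1
    field_simp
  have h2 : y ^ (-(1 + σ)) = y ^ (-σ) * y⁻¹ := by
    rw [← Real.rpow_neg_one y, ← Real.rpow_add hy0]
    congr 1
    ring
  have h3 : 1 + 2 * σ * y⁻¹ ≤ (1 - 2 / y) ^ (-σ) := by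
    rw [Real.rpow_def_of_pos ht]
    have h4 := Real.add_one_le_exp (Real.log (1 - 2 / y) * -σ)
    have h5 := Real.log_le_sub_one_of_pos ht
    have h6 : 2 / y = 2 * y⁻¹ := div_eq_mul_inv _ _
    rw [h6] at h5 h4 ⊢
    nlinarith [mul_le_mul_of_nonneg_right h5 hσ.le]
  rw [h1, h2]
  nlinarith [mul_le_mul_of_nonneg_left h3 (Real.rpow_nonneg hy0.le (-σ))]

theorem sum_range_odd_rpow_le {σ : ℝ} (hσ : 0 < σ) (n : ℕ) :
    ∑ m ∈ Finset.range n, (1 + 2 * (m : ℝ)) ^ (-(1 + σ)) ≤ 1 + 1 / (2 * σ) := by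
  have key : ∀ n : ℕ, ∑ m ∈ Finset.range (n + 1), (1 + 2 * (m : ℝ)) ^ (-(1 + σ)) ≤
      1 + 1 / (2 * σ) * (1 - (1 + 2 * (n : ℝ)) ^ (-σ)) := by
    intro n
    induction n with
    | zero => simp
    | succ n ih =>
      rw [Finset.sum_range_succ]
      have h := two_mul_rpow_le_sub hσ (y := 1 + 2 * ((n + 1 : ℕ) : ℝ)) (by
        push_cast
        nlinarith [Nat.cast_nonneg (α := ℝ) n])
      have e : 1 + 2 * ((n + 1 : ℕ) : ℝ) - 2 = 1 + 2 * (n : ℝ) := by push_cast; ring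
      rw [e] at h
      have h' : (1 + 2 * ((n + 1 : ℕ) : ℝ)) ^ (-(1 + σ)) ≤ 1 / (2 * σ) *
          ((1 + 2 * (n : ℝ)) ^ (-σ) - (1 + 2 * ((n + 1 : ℕ) : ℝ)) ^ (-σ)) := by
        rw [one_div, inv_mul_eq_div, le_div_iff₀ (by positivity)]
        linarith
      linarith
  rcases n with _ | n
  · simp only [Finset.range_zero, Finset.sum_empty]
    positivity
  · refine (key n).trans ?_
    have h1 : (0 : ℝ) ≤ (1 + 2 * (n : ℝ)) ^ (-σ) := by positivity
    have h2 : 0 ≤ 1 / (2 * σ) := by positivity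
    nlinarith

/-- `u` vanishes on `[-κ, κ]` and is dominated by `C |x|^{-s}` outside this interval. -/
structure IsTail (u : ℝ → ℂ) (C s κ : ℝ) : Prop where
  eq_zero : ∀ x, |x| ≤ κ → u x = 0
  norm_le : ∀ x, κ < |x| → ‖u x‖ ≤ C * |x| ^ (-s)

theorem IsTail.norm_le_of_mul_le {u : ℝ → ℂ} {C s κ : ℝ} (h : IsTail u C s κ) (hC : 0 ≤ C)
    (hs : 0 ≤ s) (hκ : 0 < κ) {x q : ℝ} (hq : 0 < q) (hx : κ * q ≤ |x|) :
    ‖u x‖ ≤ C * κ ^ (-s) * q ^ (-s) := by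
  rcases le_or_gt |x| κ with h1 | h1
  · rw [h.eq_zero x h1, norm_zero]
    positivity
  · refine (h.norm_le x h1).trans ?_
    rw [mul_assoc, ← Real.mul_rpow hκ.le hq.le]
    exact mul_le_mul_of_nonneg_left
      (Real.rpow_le_rpow_of_nonpos (mul_pos hκ hq) hx (neg_nonpos.2 hs)) hC

theorem IsTail.enorm_le {u : ℝ → ℂ} {C s κ : ℝ} (h : IsTail u C s κ) (hC : 0 ≤ C)
    (hs : 0 ≤ s) (hκ : 0 < κ) (x : ℝ) : ‖u x‖ₑ ≤ ENNReal.ofReal (C * κ ^ (-s)) := by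
  rw [← ofReal_norm]
  refine ENNReal.ofReal_le_ofReal ?_
  rcases le_or_gt |x| κ with h1 | h1
  · rw [h.eq_zero x h1, norm_zero]
    positivity
  · have := h.norm_le_of_mul_le hC hs hκ one_pos (by rw [mul_one]; exact h1.le)
    rwa [Real.one_rpow, mul_one] at this

theorem IsTail.tsum_nat_le {u : ℝ → ℂ} {C σ κ : ℝ} (h : IsTail u C (1 + σ) κ) (hC : 0 ≤ C)
    (hσ : 0 < σ) (hκ : 0 < κ) (p : ℕ → ℝ) (hp : ∀ m : ℕ, κ * (1 + 2 * (m : ℝ)) ≤ |p m|) :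
    ∑' m, ‖u (p m)‖ₑ ≤ ENNReal.ofReal (C * κ ^ (-(1 + σ)) * (1 + 1 / (2 * σ))) := by
  rw [ENNReal.tsum_eq_iSup_nat]
  refine iSup_le fun n => ?_
  calc ∑ m ∈ Finset.range n, ‖u (p m)‖ₑ
      ≤ ∑ m ∈ Finset.range n,
        ENNReal.ofReal (C * κ ^ (-(1 + σ)) * (1 + 2 * (m : ℝ)) ^ (-(1 + σ))) := by
        refine Finset.sum_le_sum fun m _ => ?_
        rw [← ofReal_norm]
        exact ENNReal.ofReal_le_ofReal
          (h.norm_le_of_mul_le hC (by linarith) hκ (by positivity) (hp m))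
    _ = ENNReal.ofReal (C * κ ^ (-(1 + σ)) *
        ∑ m ∈ Finset.range n, (1 + 2 * (m : ℝ)) ^ (-(1 + σ))) := by
        rw [← ENNReal.ofReal_sum_of_nonneg (fun _ _ => by positivity), Finset.mul_sum]
    _ ≤ _ := by
        refine ENNReal.ofReal_le_ofReal (mul_le_mul_of_nonneg_left ?_ (by positivity))
        exact sum_range_odd_rpow_le hσ n

theorem tsum_int_eq_add (f : ℤ → ENNReal) :
    ∑' n : ℤ, f n = ∑' m : ℕ, f m + ∑' m : ℕ, f (-(m + 1 : ℤ)) :=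
  (HasSum.of_nat_of_neg_add_one ENNReal.summable.hasSum ENNReal.summable.hasSum).tsum_eq

/-- Points of a lattice of step `T ≥ 2κ` outside `[-κ, κ]` lie, on each side of the origin, at
least as far out as `κ, 3κ, 5κ, …`. -/
theorem IsTail.tsum_lattice_le {u : ℝ → ℂ} {C σ κ T : ℝ} (h : IsTail u C (1 + σ) κ) (hC : 0 ≤ C)
    (hσ : 0 < σ) (hκ : 0 < κ) (hT : 2 * κ ≤ T) (x : ℝ) :
    ∑' n : ℤ, ‖u (x + n * T)‖ₑ ≤
      ENNReal.ofReal (2 * (C * κ ^ (-(1 + σ)) * (1 + 1 / (2 * σ)))) := by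
  have hT0 : 0 < T := by linarith
  obtain ⟨hx1, hx2⟩ := sub_toIocDiv_zsmul_mem_Ioc hT0 κ x
  set n₀ := toIocDiv hT0 κ x
  set x₀ := x - n₀ • T with hx₀
  have hre : ∑' n : ℤ, ‖u (x + n * T)‖ₑ = ∑' n : ℤ, ‖u (x₀ + n * T)‖ₑ := by
    rw [← (Equiv.addRight n₀).tsum_eq (fun n : ℤ => ‖u (x₀ + n * T)‖ₑ)]
    refine tsum_congr fun n => ?_
    simp only [Equiv.coe_addRight, hx₀, zsmul_eq_mul]
    congr 2
    push_cast
    ring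
  have hD : (0 : ℝ) ≤ C * κ ^ (-(1 + σ)) * (1 + 1 / (2 * σ)) := by positivity
  rw [hre, tsum_int_eq_add, two_mul, ENNReal.ofReal_add hD hD]
  have hpos : ∀ m : ℕ, 0 ≤ (m : ℝ) * (T - 2 * κ) := fun m =>
    mul_nonneg m.cast_nonneg (by linarith)
  refine add_le_add (h.tsum_nat_le hC hσ hκ (fun m => x₀ + ((m : ℤ) : ℝ) * T) fun m => ?_) ?_
  · refine le_trans ?_ (le_abs_self _)
    push_cast
    nlinarith [hpos m]
  · -- The first point `x₀ - T` on the left may lie inside `[-κ, κ]`, where it does not contribute.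
    rcases le_or_gt (-κ) (x₀ - T) with h1 | h1
    · have h0 : ‖u (x₀ + ((-((0 : ℕ) + 1 : ℤ) : ℤ) : ℝ) * T)‖ₑ = 0 := by
        rw [h.eq_zero, enorm_zero]
        push_cast
        rw [abs_le]
        constructor <;> linarith
      rw [tsum_eq_zero_add' ENNReal.summable, h0, zero_add]
      refine h.tsum_nat_le hC hσ hκ
        (fun m => x₀ + ((-(((m + 1 : ℕ) : ℤ) + 1) : ℤ) : ℝ) * T) fun m => ?_
      refine le_trans ?_ (neg_le_abs _)
      push_cast
      nlinarith [hpos m]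
    · refine h.tsum_nat_le hC hσ hκ (fun m => x₀ + ((-((m : ℤ) + 1) : ℤ) : ℝ) * T) fun m => ?_
      refine le_trans ?_ (neg_le_abs _)
      push_cast
      nlinarith [hpos m]

/-- The points `a^j γ` outside `[-κ, κ]` have moduli at least `κ, κa, κa², …`. -/
theorem IsTail.tsum_dilates_le {u : ℝ → ℂ} {C s κ a : ℝ} (h : IsTail u C s κ) (hC : 0 ≤ C)
    (hs : 0 < s) (hκ : 0 < κ) (ha : 1 < a) (γ : ℝ) :
    ∑' j : ℤ, ‖u (a ^ j * γ)‖ₑ ≤ ENNReal.ofReal (C * κ ^ (-s) * (a ^ s / (a ^ s - 1))) := by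
  have ha0 : 0 < a := by linarith
  rcases eq_or_ne γ 0 with rfl | hγ
  · simp [h.eq_zero 0 (by simpa using hκ.le)]
  have hγ' : 0 < |γ| := abs_pos.2 hγ
  obtain ⟨n, hn1, hn2⟩ := exists_mem_Ico_zpow (div_pos hκ hγ') ha
  rw [le_div_iff₀ hγ'] at hn1
  rw [div_lt_iff₀ hγ'] at hn2
  have habs : ∀ j : ℤ, |a ^ j * γ| = a ^ j * |γ| := fun j => by
    rw [abs_mul, abs_of_pos (zpow_pos ha0 j)]
  rw [← (Equiv.addRight (n + 1)).tsum_eq, tsum_int_eq_add]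
  have hzero : ∀ m : ℕ, ‖u (a ^ ((Equiv.addRight (n + 1)) (-(m + 1 : ℤ))) * γ)‖ₑ = 0 := by
    intro m
    rw [h.eq_zero, enorm_zero]
    rw [habs]
    refine le_trans (mul_le_mul_of_nonneg_right ?_ hγ'.le) hn1
    refine zpow_le_zpow_right₀ ha.le ?_
    simp only [Equiv.coe_addRight]
    omega
  simp only [hzero, tsum_zero, add_zero]
  have has : 1 < a ^ s := Real.one_lt_rpow ha hs
  have hr0 : 0 ≤ a ^ (-s) := by positivity
  have hr1 : a ^ (-s) < 1 := by
    rw [Real.rpow_neg ha0.le]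
    exact inv_lt_one_of_one_lt₀ has
  calc ∑' m : ℕ, ‖u (a ^ ((Equiv.addRight (n + 1)) (m : ℤ)) * γ)‖ₑ
      ≤ ∑' m : ℕ, ENNReal.ofReal (C * κ ^ (-s) * (a ^ (-s)) ^ m) := by
        refine ENNReal.tsum_le_tsum fun m => ?_
        rw [← ofReal_norm]
        refine ENNReal.ofReal_le_ofReal ?_
        have := h.norm_le_of_mul_le hC hs.le hκ (x := a ^ ((Equiv.addRight (n + 1)) (m : ℤ)) * γ)
          (q := a ^ m) (by positivity) (by
            rw [habs, Equiv.coe_addRight, zpow_add₀ ha0.ne', zpow_natCast]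
            nlinarith [mul_lt_mul_of_pos_right hn2 (pow_pos ha0 m)])
        rwa [← Real.rpow_natCast, ← Real.rpow_mul ha0.le, mul_comm (m : ℝ), Real.rpow_mul ha0.le,
          Real.rpow_natCast] at this
    _ = ENNReal.ofReal (∑' m : ℕ, C * κ ^ (-s) * (a ^ (-s)) ^ m) :=
        (ENNReal.ofReal_tsum_of_nonneg (fun m => by positivity)
          ((summable_geometric_of_lt_one hr0 hr1).mul_left _)).symm
    _ = _ := by
        rw [tsum_mul_left, tsum_geometric_of_lt_one hr0 hr1, Real.rpow_neg ha0.le]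
        congr 2
        field_simp

/-! ### Energy of the wavelet coefficients -/

theorem lintegral_mul_enorm_dilate {c : ℝ} (hc : 0 < c) {G : ℝ → ENNReal} (hG : Measurable G)
    {v : ℝ → ℂ} (hv : Measurable v) :
    ∫⁻ x, G x * ‖((Real.sqrt c : ℝ) : ℂ) * v (c * x)‖ₑ ^ 2 =
      ∫⁻ x, ‖v x‖ₑ ^ 2 * G (c⁻¹ * x) := by
  have hm : Measurable fun x => ‖v x‖ₑ ^ 2 * G (c⁻¹ * x) :=
    (hv.enorm.pow_const 2).mul (hG.comp (measurable_const_mul _))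
  have h1 : ∫⁻ x, ‖v (c * x)‖ₑ ^ 2 * G (c⁻¹ * (c * x)) =
      ENNReal.ofReal c⁻¹ * ∫⁻ x, ‖v x‖ₑ ^ 2 * G (c⁻¹ * x) := by
    rw [← lintegral_map hm (measurable_const_mul c), Real.map_volume_mul_left hc.ne',
      lintegral_smul_measure, abs_of_pos (inv_pos.2 hc), smul_eq_mul]
  have h2 : ∀ x, G x * ‖((Real.sqrt c : ℝ) : ℂ) * v (c * x)‖ₑ ^ 2 =
      ENNReal.ofReal c * (‖v (c * x)‖ₑ ^ 2 * G (c⁻¹ * (c * x))) := by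
    intro x
    rw [inv_mul_cancel_left₀ hc.ne', enorm_mul, mul_pow, ← ofReal_norm ((Real.sqrt c : ℝ) : ℂ),
      Complex.norm_real, Real.norm_eq_abs, abs_of_nonneg (Real.sqrt_nonneg c),
      ← ENNReal.ofReal_pow (Real.sqrt_nonneg c), Real.sq_sqrt hc.le]
    ring
  simp_rw [h2]
  rw [lintegral_const_mul' _ _ ENNReal.ofReal_ne_top, h1, ← mul_assoc,
    ← ENNReal.ofReal_mul hc.le, mul_inv_cancel₀ hc.ne', ENNReal.ofReal_one, one_mul]

theorem lintegral_enorm_sq_fourier (f : L2) {v : ℝ → ℂ} (hv : (𝓕 f : L2) =ᵐ[volume] v) :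
    ∫⁻ x, ‖v x‖ₑ ^ 2 = ‖f‖ₑ ^ 2 := by
  rw [← ofReal_norm f, ← Lp.norm_fourier_eq f, Lp.norm_def,
    ENNReal.ofReal_toReal (Lp.eLpNorm_ne_top _),
    eLpNorm_congr_ae hv, eLpNorm_eq_lintegral_rpow_enorm_toReal (by simp) (by simp)]
  simp only [ENNReal.toReal_ofNat, ENNReal.rpow_ofNat]
  rw [← ENNReal.rpow_natCast, ← ENNReal.rpow_mul]
  simp

theorem memLp_dilate_of_ae {c : ℝ} (hc : 0 < c) (F : L2) {v : ℝ → ℂ} (hv : F =ᵐ[volume] v) :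
    MemLp (fun x => ((Real.sqrt c : ℝ) : ℂ) * v (c * x)) 2 volume := by
  refine (memLp_dilate hc F).ae_eq ?_
  filter_upwards [ae_comp_mul_left hc.ne' hv] with x hx
  rw [hx]

theorem memLp_conj_mul {u V : ℝ → ℂ} (hu : Measurable u) {c : ℝ} (hc : ∀ x, ‖u x‖ ≤ c)
    (hV : MemLp V 2 volume) : MemLp (fun x => (starRingEnd ℂ) (u x) * V x) 2 volume := by
  refine hV.of_le_mul (c := c)
    ((continuous_star.measurable.comp hu).aestronglyMeasurable.mul hV.1)
    (ae_of_all _ fun x => ?_)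
  rw [norm_mul, RCLike.norm_conj]
  exact mul_le_mul_of_nonneg_right (hc x) (norm_nonneg _)

theorem enorm_conj (z : ℂ) : ‖(starRingEnd ℂ) z‖ₑ = ‖z‖ₑ := by
  rw [← ofReal_norm, RCLike.norm_conj, ofReal_norm]

/-- Energy at the scale `j`, when `conj φ̂(γ) f̂(a^j γ)` is supported in an interval of
length `1/b`. -/
theorem tsum_enorm_inner_scale_eq {a : ℝ} (ha : 0 < a) {b : ℝ} (hb : 0 < b) (φ f : L2)
    {u v : ℝ → ℂ} (hum : Measurable u) (hvm : Measurable v) (hu : (𝓕 φ : L2) =ᵐ[volume] u)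
    (hv : (𝓕 f : L2) =ᵐ[volume] v) {c : ℝ} (hc : ∀ x, ‖u x‖ ≤ c) (j : ℤ) (t : ℝ)
    (hsupp : ∀ x, x ∉ Set.Ioc t (t + 1 / b) → u x = 0 ∨ v (a ^ j * x) = 0) :
    ∑' k : ℤ, ‖inner ℂ (waveletSystem ha b φ (j, k)) f‖ₑ ^ 2 =
      ENNReal.ofReal (1 / b) * ∫⁻ γ, ‖v γ‖ₑ ^ 2 * ‖u (a ^ (-j) * γ)‖ₑ ^ 2 := by
  have hj := zpow_pos ha j
  simp_rw [inner_waveletSystem ha b φ f hu hv]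
  have h := tsum_enorm_sq_integral_expChar hb t (memLp_conj_mul hum hc
    (memLp_dilate_of_ae hj _ hv)) (fun x hx => by rcases hsupp x hx with h | h <;> simp [h])
  refine h.trans ?_
  simp_rw [enorm_mul ((starRingEnd ℂ) _), enorm_conj, mul_pow]
  rw [lintegral_mul_enorm_dilate hj (hum.enorm.pow_const 2) hvm, zpow_neg]

/-- Energy at the scale `j`, for a symbol with bounded `1/b`-periodization; `u'` is any function
that agrees with `φ̂` wherever `f̂(a^j ·)` does not vanish. -/
theorem tsum_enorm_inner_scale_le {a : ℝ} (ha : 0 < a) {b : ℝ} (hb : 0 < b) (φ f : L2)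
    {u u' v : ℝ → ℂ} (hum : Measurable u') (hvm : Measurable v) (hu : (𝓕 φ : L2) =ᵐ[volume] u)
    (hv : (𝓕 f : L2) =ᵐ[volume] v) {C M : ℝ} (hC : ∀ x, ‖u' x‖ₑ ≤ ENNReal.ofReal C)
    (hu'2 : MemLp u' 2 volume) (j : ℤ) (hagree : ∀ x, v (a ^ j * x) ≠ 0 → u x = u' x)
    (hM : ∀ x, ∑' n : ℤ, ‖u' (x + n * (1 / b))‖ₑ ≤ ENNReal.ofReal M) :
    ∑' k : ℤ, ‖inner ℂ (waveletSystem ha b φ (j, k)) f‖ₑ ^ 2 ≤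
      ENNReal.ofReal (1 / b) *
        (ENNReal.ofReal M * ∫⁻ γ, ‖v γ‖ₑ ^ 2 * ‖u' (a ^ (-j) * γ)‖ₑ) := by
  have hj := zpow_pos ha j
  simp_rw [inner_waveletSystem ha b φ f hu hv]
  have hconj : Measurable fun x => (starRingEnd ℂ) (u' x) := continuous_star.measurable.comp hum
  have hV := memLp_dilate_of_ae hj _ hv
  have hVm : Measurable fun x => ((Real.sqrt (a ^ j) : ℝ) : ℂ) * v (a ^ j * x) :=
    (hvm.comp (measurable_const_mul _)).const_mul _
  have heq : ∀ x, (starRingEnd ℂ) (u x) * (((Real.sqrt (a ^ j) : ℝ) : ℂ) * v (a ^ j * x)) =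
      (starRingEnd ℂ) (u' x) * (((Real.sqrt (a ^ j) : ℝ) : ℂ) * v (a ^ j * x)) := by
    intro x
    by_cases h : v (a ^ j * x) = 0
    · simp [h]
    · rw [hagree x h]
  simp_rw [heq]
  have hE : ∫⁻ x, ‖(starRingEnd ℂ) (u' x)‖ₑ *
      ‖((Real.sqrt (a ^ j) : ℝ) : ℂ) * v (a ^ j * x)‖ₑ ^ 2 =
      ∫⁻ γ, ‖v γ‖ₑ ^ 2 * ‖u' (a ^ (-j) * γ)‖ₑ := by
    simp_rw [enorm_conj]
    rw [lintegral_mul_enorm_dilate hj hum.enorm hvm, zpow_neg]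
  rw [← hE]
  refine tsum_enorm_sq_integral_expChar_le hb hconj hVm ENNReal.ofReal_ne_top ?_ ?_
    (fun x => by simpa only [enorm_conj] using hM x)
  · have := hu'2.star.integrable_mul hV
    exact this
  · rw [hE]
    refine ne_of_lt (lt_of_le_of_lt (lintegral_mono fun γ => mul_le_mul_right (hC _) _) ?_)
    rw [lintegral_mul_const' _ _ ENNReal.ofReal_ne_top, lintegral_enorm_sq_fourier f hv]
    exact ENNReal.mul_lt_top (ENNReal.pow_lt_top enorm_lt_top) ENNReal.ofReal_lt_top

/-- `B` is a Bessel bound for the family `g`. -/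
def BesselBound {ι : Type*} (g : ι → L2) (B : ℝ) : Prop :=
  ∀ f : L2, ∑' i, ‖inner ℂ (g i) f‖ₑ ^ 2 ≤ ENNReal.ofReal B * ‖f‖ₑ ^ 2

theorem tsum_waveletSystem_eq {a : ℝ} (ha : 0 < a) (b : ℝ) (φ f : L2) :
    ∑' p : ℤ × ℤ, ‖inner ℂ (waveletSystem ha b φ p) f‖ₑ ^ 2 =
      ∑' j : ℤ, ∑' k : ℤ, ‖inner ℂ (waveletSystem ha b φ (j, k)) f‖ₑ ^ 2 :=
  ENNReal.tsum_prod (f := fun j k => ‖inner ℂ (waveletSystem ha b φ (j, k)) f‖ₑ ^ 2)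

theorem tsum_lintegral_dilates {a : ℝ} {v : ℝ → ℂ} {G : ℝ → ENNReal} (hv : Measurable v)
    (hG : Measurable G) :
    ∑' j : ℤ, ∫⁻ γ, ‖v γ‖ₑ ^ 2 * G (a ^ (-j) * γ) =
      ∫⁻ γ, ‖v γ‖ₑ ^ 2 * ∑' j : ℤ, G (a ^ j * γ) := by
  rw [← lintegral_tsum (f := fun (j : ℤ) γ => ‖v γ‖ₑ ^ 2 * G (a ^ (-j) * γ))
    fun j => ((hv.enorm.pow_const 2).mul (hG.comp (measurable_const_mul _))).aemeasurable]
  refine lintegral_congr fun γ => ?_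
  rw [ENNReal.tsum_mul_left, ← (Equiv.neg ℤ).tsum_eq (fun j => G (a ^ j * γ))]
  rfl

/-- For a symbol supported in `[-κ, κ]` with `2κ < 1/b`, the energy of the wavelet coefficients is
given by the Calderón sum alone. -/
theorem tsum_enorm_inner_bandlimited {a : ℝ} (ha : 0 < a) {b : ℝ} (hb : 0 < b) (φ f : L2)
    {u v : ℝ → ℂ} (hum : Measurable u) (hvm : Measurable v) (hu : (𝓕 φ : L2) =ᵐ[volume] u)
    (hv : (𝓕 f : L2) =ᵐ[volume] v) {c : ℝ} (hc : ∀ x, ‖u x‖ ≤ c) {κ : ℝ} (hκ : 2 * κ < 1 / b)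
    (hsupp : ∀ x, κ < |x| → u x = 0) :
    ∑' p : ℤ × ℤ, ‖inner ℂ (waveletSystem ha b φ p) f‖ₑ ^ 2 =
      ENNReal.ofReal (1 / b) * ∫⁻ γ, ‖v γ‖ₑ ^ 2 * ∑' j : ℤ, ‖u (a ^ j * γ)‖ₑ ^ 2 := by
  rw [tsum_waveletSystem_eq]
  have h : ∀ j : ℤ, _ := fun j => tsum_enorm_inner_scale_eq ha hb φ f hum hvm hu hv hc j
    (-(1 / b) / 2) (fun x hx => Or.inl (hsupp x (by
      by_contra hle
      rw [not_lt, abs_le] at hle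
      exact hx ⟨by linarith, by linarith⟩)))
  simp_rw [h]
  rw [ENNReal.tsum_mul_left, tsum_lintegral_dilates hvm (hum.enorm.pow_const 2)]

theorem BesselBound.of_bandlimited {a : ℝ} (ha : 0 < a) {b : ℝ} (hb : 0 < b) (φ : L2)
    {u : ℝ → ℂ} (hum : Measurable u) (hu : (𝓕 φ : L2) =ᵐ[volume] u) {c : ℝ} (hc : ∀ x, ‖u x‖ ≤ c)
    {κ : ℝ} (hκ : 2 * κ < 1 / b) (hsupp : ∀ x, κ < |x| → u x = 0) {S : ℝ}
    (hS : ∀ᵐ γ : ℝ, ∑' j : ℤ, ‖u (a ^ j * γ)‖ₑ ^ 2 ≤ ENNReal.ofReal S) :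
    BesselBound (waveletSystem ha b φ) (1 / b * S) := by
  intro f
  rw [tsum_enorm_inner_bandlimited ha hb φ f hum (Lp.stronglyMeasurable (𝓕 f)).measurable hu
    ae_eq_rfl hc hκ hsupp, ENNReal.ofReal_mul (by positivity), mul_assoc]
  gcongr
  calc _ ≤ ∫⁻ γ, ‖(𝓕 f : L2) γ‖ₑ ^ 2 * ENNReal.ofReal S := by
        refine lintegral_mono_ae ?_
        filter_upwards [hS] with γ hγ
        gcongr
    _ = _ := by
        rw [lintegral_mul_const' _ _ ENNReal.ofReal_ne_top,
          lintegral_enorm_sq_fourier f ae_eq_rfl, mul_comm]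

/-- A wavelet system whose symbol vanishes near the origin and decays at infinity is a Bessel
sequence, with a bound that is small when the symbol is a tail. -/
theorem BesselBound.of_tail {a : ℝ} (ha : 1 < a) {b : ℝ} (hb : 0 < b) (φ : L2)
    {u : ℝ → ℂ} (hum : Measurable u) (hu : (𝓕 φ : L2) =ᵐ[volume] u) {C σ κ : ℝ} (hC : 0 ≤ C)
    (hσ : 0 < σ) (hκ0 : 0 < κ) (hκ : 2 * κ ≤ 1 / b) (h : IsTail u C (1 + σ) κ) :
    BesselBound (waveletSystem (zero_lt_one.trans ha) b φ)
      (1 / b * (2 * (C * κ ^ (-(1 + σ)) * (1 + 1 / (2 * σ))) *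
        (C * κ ^ (-(1 + σ)) * (a ^ (1 + σ) / (a ^ (1 + σ) - 1))))) := by
  intro f
  have ha0 := zero_lt_one.trans ha
  have hvm := (Lp.stronglyMeasurable (𝓕 f)).measurable
  have hu2 : MemLp u 2 volume := (Lp.memLp (𝓕 φ)).ae_eq hu
  rw [tsum_waveletSystem_eq]
  have hX : 0 ≤ 2 * (C * κ ^ (-(1 + σ)) * (1 + 1 / (2 * σ))) := by positivity
  have hM := h.tsum_lattice_le hC hσ hκ0 hκ
  have hY := h.tsum_dilates_le hC (by linarith) hκ0 ha
  set X := 2 * (C * κ ^ (-(1 + σ)) * (1 + 1 / (2 * σ)))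
  set Y := C * κ ^ (-(1 + σ)) * (a ^ (1 + σ) / (a ^ (1 + σ) - 1))
  refine (ENNReal.tsum_le_tsum fun j => tsum_enorm_inner_scale_le ha0 hb φ f hum hvm hu ae_eq_rfl
    (h.enorm_le hC (by linarith) hκ0) hu2 j (fun _ _ => rfl)
    hM).trans ?_
  rw [ENNReal.tsum_mul_left, ENNReal.tsum_mul_left, tsum_lintegral_dilates hvm hum.enorm,
    ENNReal.ofReal_mul (p := 1 / b) (by positivity), ENNReal.ofReal_mul hX, mul_assoc, mul_assoc]
  refine mul_le_mul_right (mul_le_mul_right ?_ _) _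
  calc _ ≤ ∫⁻ γ, ‖(𝓕 f : L2) γ‖ₑ ^ 2 * ENNReal.ofReal Y := by
        refine lintegral_mono fun γ => ?_
        gcongr
        exact hY γ
    _ = _ := by
        rw [lintegral_mul_const' _ _ ENNReal.ofReal_ne_top,
          lintegral_enorm_sq_fourier f ae_eq_rfl, mul_comm]

/-! ### The Calderón sum of a wavelet frame -/

/-- The function whose Fourier transform is the indicator function of `E`. -/
def fourierIndicator {E : Set ℝ} (hE : MeasurableSet E) (hE' : volume E ≠ ⊤) : L2 :=
  𝓕⁻ (indicatorConstLp 2 hE hE' (1 : ℂ) : L2)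

theorem fourier_fourierIndicator {E : Set ℝ} (hE : MeasurableSet E) (hE' : volume E ≠ ⊤) :
    (𝓕 (fourierIndicator hE hE') : L2) =ᵐ[volume] E.indicator fun _ => (1 : ℂ) := by
  rw [fourierIndicator, FourierTransform.fourier_fourierInv_eq]
  exact indicatorConstLp_coeFn

theorem lintegral_enorm_indicator_sq_mul {E : Set ℝ} (hE : MeasurableSet E) (G : ℝ → ENNReal) :
    ∫⁻ γ, ‖E.indicator (fun _ => (1 : ℂ)) γ‖ₑ ^ 2 * G γ = ∫⁻ γ in E, G γ := by
  rw [← lintegral_indicator hE]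
  refine lintegral_congr fun γ => ?_
  by_cases h : γ ∈ E <;> simp [h]

theorem enorm_fourierIndicator_sq {E : Set ℝ} (hE : MeasurableSet E) (hE' : volume E ≠ ⊤) :
    ‖fourierIndicator hE hE'‖ₑ ^ 2 = volume E := by
  rw [← lintegral_enorm_sq_fourier _ (fourier_fourierIndicator hE hE')]
  have := lintegral_enorm_indicator_sq_mul hE 1
  simpa using this

/-- An inequality between functions holds almost everywhere if it holds in the mean over all
sufficiently small sets. -/
theorem ae_le_of_setLIntegral_le_of_subset_Ioc {G H : ℝ → ENNReal} (hG : Measurable G) {δ : ℝ}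
    (hδ : 0 < δ) (h : ∀ (E : Set ℝ) (c : ℝ), MeasurableSet E → E ⊆ Set.Ioc c (c + δ) →
      ∫⁻ x in E, G x ≤ ∫⁻ x in E, H x) : G ≤ᵐ[volume] H := by
  have h1 : ∀ n : ℤ, ∀ᵐ x ∂volume.restrict (Set.Ioc (n • δ) ((n + 1) • δ)), G x ≤ H x := by
    intro n
    refine ae_le_of_forall_setLIntegral_le_of_sigmaFinite hG fun s hs _ => ?_
    rw [Measure.restrict_restrict hs]
    refine h _ (n • δ) (hs.inter measurableSet_Ioc) fun x hx => ?_
    rw [← add_one_zsmul]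
    exact hx.2
  have h2 := ae_restrict_iUnion_iff (μ := volume) (fun n : ℤ => Set.Ioc (n • δ) ((n + 1) • δ))
    (fun x => G x ≤ H x)
  rw [iUnion_Ioc_zsmul hδ, Measure.restrict_univ] at h2
  exact h2.2 h1

/-- Energy at fine scales for a function whose Fourier transform is the indicator function of a
small set. -/
theorem tsum_enorm_inner_fourierIndicator {a : ℝ} (ha : 1 < a) {b : ℝ} (hb : 0 < b) (φ : L2)
    {u : ℝ → ℂ} (hum : Measurable u) (hu : (𝓕 φ : L2) =ᵐ[volume] u) {C : ℝ}
    (hC : ∀ x, ‖u x‖ ≤ C) {E : Set ℝ} (hE : MeasurableSet E) (hE' : volume E ≠ ⊤) {J j : ℤ}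
    (hJ : J ≤ j) {c : ℝ} (hEc : E ⊆ Set.Ioc c (c + a ^ J / b)) :
    ∑' k : ℤ, ‖inner ℂ (waveletSystem (zero_lt_one.trans ha) b φ (j, k))
        (fourierIndicator hE hE')‖ₑ ^ 2 =
      ENNReal.ofReal (1 / b) * ∫⁻ γ in E, ‖u (a ^ (-j) * γ)‖ₑ ^ 2 := by
  have ha0 := zero_lt_one.trans ha
  have hj := zpow_pos ha0 j
  rw [tsum_enorm_inner_scale_eq ha0 hb φ _ hum (measurable_const.indicator hE) hu
    (fourier_fourierIndicator hE hE') hC j (a ^ (-j) * c),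
    lintegral_enorm_indicator_sq_mul hE]
  intro x hx
  refine Or.inr (Set.indicator_of_notMem (fun hxE => hx ?_) _)
  obtain ⟨h1, h2⟩ := hEc hxE
  have h3 : a ^ J / b ≤ a ^ j / b := by
    gcongr
    exact ha.le
  rw [zpow_neg]
  constructor
  · rw [inv_mul_lt_iff₀ hj]
    exact h1
  · rw [← le_div_iff₀' hj] at h2
    refine h2.trans ((div_le_div_of_nonneg_right (add_le_add_right h3 c) hj.le).trans_eq ?_)
    field_simp

/-- The Calderón sum of a Bessel wavelet system with bound `B` is at most `bB`. -/
theorem calderon_le {a : ℝ} (ha : 1 < a) {b : ℝ} (hb : 0 < b) (φ : L2) {u : ℝ → ℂ}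
    (hum : Measurable u) (hu : (𝓕 φ : L2) =ᵐ[volume] u) {C : ℝ} (hC : ∀ x, ‖u x‖ ≤ C) {B : ℝ}
    (hB : BesselBound (waveletSystem (zero_lt_one.trans ha) b φ) B) :
    ∀ᵐ γ : ℝ, ∑' j : ℤ, ‖u (a ^ j * γ)‖ₑ ^ 2 ≤ ENNReal.ofReal (b * B) := by
  have ha0 := zero_lt_one.trans ha
  have hmeas : ∀ j : ℤ, Measurable fun γ => ‖u (a ^ (-j) * γ)‖ₑ ^ 2 := fun j =>
    (hum.comp (measurable_const_mul _)).enorm.pow_const 2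
  have key : ∀ S : Finset ℤ, ∀ᵐ γ : ℝ,
      ∑ j ∈ S, ‖u (a ^ (-j) * γ)‖ₑ ^ 2 ≤ ENNReal.ofReal (b * B) := by
    intro S
    obtain ⟨J, hJ⟩ := S.bddBelow
    refine ae_le_of_setLIntegral_le_of_subset_Ioc
      (Finset.measurable_sum S fun j _ => hmeas j)
      (div_pos (zpow_pos ha0 J) hb) fun E c hE hEc => ?_
    have hE' : volume E ≠ ⊤ := ((measure_mono hEc).trans_lt measure_Ioc_lt_top).ne
    have h := hB (fourierIndicator hE hE')
    rw [enorm_fourierIndicator_sq, tsum_waveletSystem_eq] at h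
    have h2 := (ENNReal.sum_le_tsum S).trans h
    rw [Finset.sum_congr rfl fun j hj => tsum_enorm_inner_fourierIndicator ha hb φ hum hu hC hE hE'
      (hJ hj) hEc, ← Finset.mul_sum, ← lintegral_finsetSum S fun j _ => hmeas j] at h2
    rw [setLIntegral_const, ENNReal.ofReal_mul hb.le, mul_assoc]
    refine le_trans ?_ (mul_le_mul_right h2 _)
    rw [← mul_assoc, ← ENNReal.ofReal_mul hb.le, mul_one_div_cancel hb.ne', ENNReal.ofReal_one,
      one_mul]
  filter_upwards [ae_all_iff.2 key] with γ hγ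
  rw [← (Equiv.neg ℤ).tsum_eq, ENNReal.tsum_eq_iSup_sum]
  exact iSup_le hγ

theorem isTail_indicator {u : ℝ → ℂ} {C s : ℝ} (h : ∀ x, x ≠ 0 → ‖u x‖ ≤ C * |x| ^ (-s)) {κ : ℝ}
    (hκ : 0 < κ) : IsTail ({x | κ < |x|}.indicator u) C s κ := by
  refine ⟨fun x hx => Set.indicator_of_notMem (by simpa using hx) u, fun x hx => ?_⟩
  rw [Set.indicator_of_mem (show x ∈ {x | κ < |x|} from hx)]
  exact h x (abs_pos.1 (hκ.trans hx))

theorem measurableSet_lt_abs (κ : ℝ) : MeasurableSet {x : ℝ | κ < |x|} :=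
  measurableSet_lt measurable_const measurable_id.abs

/-- Away from the origin the Calderón sum is bounded below by `bA`, up to the contribution of the
coarse scales to the energy. At these scales only the values of the symbol beyond `κ'` matter. -/
theorem le_calderon_add {a : ℝ} (ha : 1 < a) {b : ℝ} (hb : 0 < b) (φ : L2) {u : ℝ → ℂ}
    (hum : Measurable u) (hu : (𝓕 φ : L2) =ᵐ[volume] u) {C σ : ℝ} (hC0 : 0 ≤ C) (hσ : 0 < σ)
    (hC : ∀ x, ‖u x‖ ≤ C) (hdecay : ∀ x, x ≠ 0 → ‖u x‖ ≤ C * |x| ^ (-(1 + σ))) {A : ℝ}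
    (hA : ∀ f : L2, ENNReal.ofReal A * ‖f‖ₑ ^ 2 ≤
      ∑' p, ‖inner ℂ (waveletSystem (zero_lt_one.trans ha) b φ p) f‖ₑ ^ 2)
    {κ κ' r : ℝ} (hκ0 : 0 < κ) (hκ : 2 * κ ≤ 1 / b) (hκ' : κ ≤ κ') (hr : 0 < r) :
    ∀ᵐ γ : ℝ, r ≤ |γ| → ENNReal.ofReal (b * A) ≤ ∑' j : ℤ, ‖u (a ^ j * γ)‖ₑ ^ 2 +
      ENNReal.ofReal (2 * (C * κ ^ (-(1 + σ)) * (1 + 1 / (2 * σ)))) *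
        ENNReal.ofReal (C * κ' ^ (-(1 + σ)) * (a ^ (1 + σ) / (a ^ (1 + σ) - 1))) := by
  have ha0 := zero_lt_one.trans ha
  have hκ'0 := hκ0.trans_le hκ'
  set u' : ℝ → ℂ := {x | κ' < |x|}.indicator u with hu'
  have hum' : Measurable u' := hum.indicator (measurableSet_lt_abs κ')
  have htail : IsTail u' C (1 + σ) κ' := isTail_indicator hdecay hκ'0
  have hM : ∀ x, ∑' n : ℤ, ‖u' (x + n * (1 / b))‖ₑ ≤
      ENNReal.ofReal (2 * (C * κ ^ (-(1 + σ)) * (1 + 1 / (2 * σ)))) := fun x => by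
    refine le_trans (ENNReal.tsum_le_tsum fun n => ?_)
      ((isTail_indicator hdecay hκ0).tsum_lattice_le hC0 hσ hκ0 hκ x)
    by_cases h : κ' < |x + n * (1 / b)|
    · rw [hu', Set.indicator_of_mem (show _ ∈ {x | κ' < |x|} from h),
        Set.indicator_of_mem (show _ ∈ {x | κ < |x|} from hκ'.trans_lt h)]
    · rw [hu', Set.indicator_of_notMem (show _ ∉ {x | κ' < |x|} from h), enorm_zero]
      exact zero_le
  have hY := htail.tsum_dilates_le hC0 (by linarith : 0 < 1 + σ) hκ'0 ha
  set M := 2 * (C * κ ^ (-(1 + σ)) * (1 + 1 / (2 * σ)))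
  set Y := C * κ' ^ (-(1 + σ)) * (a ^ (1 + σ) / (a ^ (1 + σ) - 1))
  have hu2 : MemLp u' 2 volume :=
    ((Lp.memLp (𝓕 φ)).ae_eq hu).indicator (measurableSet_lt_abs κ')
  obtain ⟨m, hm⟩ := pow_unbounded_of_one_lt (κ' / r) ha
  rw [div_lt_iff₀ hr] at hm
  have hGm : MeasurableSet {x : ℝ | r ≤ |x|} :=
    measurableSet_le measurable_const measurable_id.abs
  have main := ae_le_of_setLIntegral_le_of_subset_Ioc
    (G := {x : ℝ | r ≤ |x|}.indicator fun _ => ENNReal.ofReal (b * A))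
    (H := fun γ => ∑' j : ℤ, ‖u (a ^ j * γ)‖ₑ ^ 2 + ENNReal.ofReal M * ENNReal.ofReal Y)
    (measurable_const.indicator hGm) (div_pos (zpow_pos ha0 (-(m : ℤ))) hb) ?_
  · filter_upwards [main] with γ hγ hrγ
    rwa [Set.indicator_of_mem (show γ ∈ {x : ℝ | r ≤ |x|} from hrγ)] at hγ
  intro E₀ c hE₀ hE₀c
  rw [setLIntegral_indicator hGm]
  refine le_trans ?_ (lintegral_mono_set (Set.inter_subset_right (s := {x : ℝ | r ≤ |x|})))
  have hE : MeasurableSet ({x : ℝ | r ≤ |x|} ∩ E₀) := hGm.inter hE₀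
  have hEr : ∀ x ∈ {x : ℝ | r ≤ |x|} ∩ E₀, r ≤ |x| := fun x hx => hx.1
  have hEc := Set.inter_subset_right.trans hE₀c (a := {x : ℝ | r ≤ |x|} ∩ E₀)
  set E := {x : ℝ | r ≤ |x|} ∩ E₀
  have hE' : volume E ≠ ⊤ := ((measure_mono hEc).trans_lt measure_Ioc_lt_top).ne
  have h := hA (fourierIndicator hE hE')
  rw [enorm_fourierIndicator_sq, tsum_waveletSystem_eq] at h
  have hscale : ∀ j : ℤ, ∑' k : ℤ, ‖inner ℂ (waveletSystem ha0 b φ (j, k))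
        (fourierIndicator hE hE')‖ₑ ^ 2 ≤ ENNReal.ofReal (1 / b) *
      ((∫⁻ γ, ‖E.indicator (fun _ => (1 : ℂ)) γ‖ₑ ^ 2 * ‖u (a ^ (-j) * γ)‖ₑ ^ 2) +
      ENNReal.ofReal M *
        ∫⁻ γ, ‖E.indicator (fun _ => (1 : ℂ)) γ‖ₑ ^ 2 * ‖u' (a ^ (-j) * γ)‖ₑ) := by
    intro j
    rcases le_or_gt (-(m : ℤ)) j with hj | hj
    · rw [tsum_enorm_inner_fourierIndicator ha hb φ hum hu hC hE hE' hj hEc,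
        lintegral_enorm_indicator_sq_mul hE]
      exact mul_le_mul_right le_self_add _
    · refine (tsum_enorm_inner_scale_le ha0 hb φ _ hum' (measurable_const.indicator hE) hu
        (fourier_fourierIndicator hE hE') (htail.enorm_le hC0 (by linarith) hκ'0) hu2 j
        (fun x hx => ?_) hM).trans (mul_le_mul_right le_add_self _)
      have hxE : a ^ j * x ∈ E := by
        by_contra hn
        exact hx (Set.indicator_of_notMem hn _)
      have h1 := hEr _ hxE
      rw [abs_mul, abs_of_pos (zpow_pos ha0 j)] at h1
      have h2 : a ^ j ≤ (a ^ m)⁻¹ := by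
        rw [← zpow_natCast, ← zpow_neg]
        exact zpow_le_zpow_right₀ ha.le hj.le
      have h3 : r ≤ (a ^ m)⁻¹ * |x| := h1.trans (mul_le_mul_of_nonneg_right h2 (abs_nonneg x))
      rw [le_inv_mul_iff₀ (pow_pos ha0 m)] at h3
      rw [hu', Set.indicator_of_mem (show x ∈ {x | κ' < |x|} from hm.trans_le h3)]
  have hvm : Measurable (E.indicator fun _ => (1 : ℂ)) := measurable_const.indicator hE
  have h2 := h.trans (ENNReal.tsum_le_tsum hscale)
  rw [ENNReal.tsum_mul_left, ENNReal.tsum_add, ENNReal.tsum_mul_left,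
    tsum_lintegral_dilates hvm (hum.enorm.pow_const 2), tsum_lintegral_dilates hvm hum'.enorm,
    lintegral_enorm_indicator_sq_mul hE, lintegral_enorm_indicator_sq_mul hE] at h2
  have h3 : ∫⁻ γ in E, ∑' j : ℤ, ‖u' (a ^ j * γ)‖ₑ ≤ ENNReal.ofReal Y * volume E := by
    rw [← setLIntegral_const]
    exact lintegral_mono fun γ => hY γ
  rw [lintegral_add_right _ measurable_const, setLIntegral_const, setLIntegral_const,
    ENNReal.ofReal_mul hb.le, mul_assoc, mul_assoc]
  refine (mul_le_mul_right h2 _).trans ?_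
  rw [← mul_assoc, ← ENNReal.ofReal_mul hb.le, mul_one_div_cancel hb.ne', ENNReal.ofReal_one,
    one_mul]
  gcongr

/-- The Calderón sum of a wavelet frame with lower bound `A` is at least `bA`. -/
theorem le_calderon {a : ℝ} (ha : 1 < a) {b : ℝ} (hb : 0 < b) (φ : L2) {u : ℝ → ℂ}
    (hum : Measurable u) (hu : (𝓕 φ : L2) =ᵐ[volume] u) {C σ : ℝ} (hC0 : 0 ≤ C) (hσ : 0 < σ)
    (hC : ∀ x, ‖u x‖ ≤ C) (hdecay : ∀ x, x ≠ 0 → ‖u x‖ ≤ C * |x| ^ (-(1 + σ))) {A : ℝ}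
    (hA : ∀ f : L2, ENNReal.ofReal A * ‖f‖ₑ ^ 2 ≤
      ∑' p, ‖inner ℂ (waveletSystem (zero_lt_one.trans ha) b φ p) f‖ₑ ^ 2) :
    ∀ᵐ γ : ℝ, ENNReal.ofReal (b * A) ≤ ∑' j : ℤ, ‖u (a ^ j * γ)‖ₑ ^ 2 := by
  have hκ0 : 0 < 1 / b / 2 := by positivity
  have h0 : ∀ᵐ γ : ℝ, γ ≠ 0 := by
    simp [ae_iff, measure_singleton]
  have key : ∀ n i : ℕ, _ := fun n i => le_calderon_add ha hb φ hum hu hC0 hσ hC hdecay hA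
    (κ := 1 / b / 2) (κ' := 1 / b / 2 + i) (r := 1 / ((n : ℝ) + 1)) hκ0 (by linarith) (by simp)
    (by positivity)
  filter_upwards [h0, ae_all_iff.2 fun n => ae_all_iff.2 (key n)] with γ hγ0 hγ
  obtain ⟨n, hn⟩ := exists_nat_one_div_lt (abs_pos.2 hγ0)
  have hlim : Tendsto (fun i : ℕ => C * (1 / b / 2 + (i : ℝ)) ^ (-(1 + σ)) *
      (a ^ (1 + σ) / (a ^ (1 + σ) - 1))) atTop (𝓝 0) := by
    have h1 : Tendsto (fun i : ℕ => 1 / b / 2 + (i : ℝ)) atTop atTop :=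
      tendsto_atTop_add_const_left _ _ tendsto_natCast_atTop_atTop
    have h2 := (tendsto_rpow_neg_atTop (by linarith : 0 < 1 + σ)).comp h1
    simpa using (h2.const_mul C).mul_const (a ^ (1 + σ) / (a ^ (1 + σ) - 1))
  have hlim2 := (ENNReal.Tendsto.const_mul (ENNReal.tendsto_ofReal hlim)
    (Or.inr (ENNReal.ofReal_ne_top
      (r := 2 * (C * (1 / b / 2) ^ (-(1 + σ)) * (1 + 1 / (2 * σ))))))).const_add
    (∑' j : ℤ, ‖u (a ^ j * γ)‖ₑ ^ 2)
  rw [ENNReal.ofReal_zero, mul_zero, add_zero] at hlim2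
  exact ge_of_tendsto' hlim2 fun i => hγ n i hn.le

/-! ### Bessel sequences and mixed frame expansions -/

theorem enorm_sq_eq_ofReal {E : Type*} [SeminormedAddCommGroup E] (x : E) :
    ‖x‖ₑ ^ 2 = ENNReal.ofReal (‖x‖ ^ 2) := by
  rw [ENNReal.ofReal_pow (norm_nonneg _), ofReal_norm]

section Bessel

variable {ι : Type*} {g gt : ι → L2} {B Bt : ℝ}

theorem BesselBound.mono (h : BesselBound g B) (hB : B ≤ Bt) : BesselBound g Bt := fun f =>
  (h f).trans (mul_le_mul_left (ENNReal.ofReal_le_ofReal hB) _)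

theorem BesselBound.summable (h : BesselBound g B) (f : L2) :
    Summable fun i => ‖inner ℂ (g i) f‖ ^ 2 := by
  have h1 : ∑' i, ENNReal.ofReal (‖inner ℂ (g i) f‖ ^ 2) ≠ ⊤ := by
    simp_rw [← enorm_sq_eq_ofReal]
    exact ((h f).trans_lt (ENNReal.mul_lt_top ENNReal.ofReal_lt_top
      (ENNReal.pow_lt_top enorm_lt_top))).ne
  have h2 := ENNReal.summable_toReal h1
  simpa only [ENNReal.toReal_ofReal (sq_nonneg ‖_‖)] using h2

theorem BesselBound.tsum_le (hB : 0 ≤ B) (h : BesselBound g B) (f : L2) :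
    ∑' i, ‖inner ℂ (g i) f‖ ^ 2 ≤ B * ‖f‖ ^ 2 := by
  have h1 := h f
  simp_rw [enorm_sq_eq_ofReal] at h1
  rwa [← ENNReal.ofReal_tsum_of_nonneg (fun _ => by positivity) (h.summable f),
    ← ENNReal.ofReal_mul hB, ENNReal.ofReal_le_ofReal_iff (by positivity)] at h1

theorem BesselBound.isBessel (h : BesselBound g B) : IsBessel g := by
  have hB : 0 < max B 1 := lt_max_of_lt_right one_pos
  have h' := h.mono (le_max_left B 1)
  exact ⟨max B 1, hB, fun f => ⟨h'.summable f, h'.tsum_le hB.le f⟩⟩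

theorem IsBessel.exists_besselBound (h : IsBessel g) : ∃ B, 0 < B ∧ BesselBound g B := by
  obtain ⟨B, hB, hf⟩ := h
  refine ⟨B, hB, fun f => ?_⟩
  simp_rw [enorm_sq_eq_ofReal]
  rw [← ENNReal.ofReal_tsum_of_nonneg (fun _ => by positivity) (hf f).1, ← ENNReal.ofReal_mul hB.le]
  exact ENNReal.ofReal_le_ofReal (hf f).2

theorem BesselBound.add (hB : 0 ≤ B) (hBt : 0 ≤ Bt) (h : BesselBound g B)
    (ht : BesselBound gt Bt) : BesselBound (fun i => g i + gt i) (2 * (B + Bt)) := by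
  intro f
  calc ∑' i, ‖inner ℂ (g i + gt i) f‖ₑ ^ 2
      ≤ ∑' i, 2 * (‖inner ℂ (g i) f‖ₑ ^ 2 + ‖inner ℂ (gt i) f‖ₑ ^ 2) := by
        refine ENNReal.tsum_le_tsum fun i => ?_
        rw [inner_add_left]
        have : ‖inner ℂ (g i) f + inner ℂ (gt i) f‖₊ ^ 2 ≤
            2 * (‖inner ℂ (g i) f‖₊ ^ 2 + ‖inner ℂ (gt i) f‖₊ ^ 2) :=
          (pow_le_pow_left' (nnnorm_add_le _ _) 2).trans add_sq_le
        simp only [enorm_eq_nnnorm]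
        exact_mod_cast this
    _ ≤ _ := by
        rw [ENNReal.tsum_mul_left, ENNReal.tsum_add, ENNReal.ofReal_mul zero_le_two,
          ENNReal.ofReal_add hB hBt, ENNReal.ofReal_ofNat, mul_assoc, add_mul]
        gcongr
        · exact h f
        · exact ht f

/-- The synthesis operator of a Bessel sequence is bounded on finitely supported sequences. -/
theorem BesselBound.norm_sum_smul_sq_le (hB : 0 ≤ B) (h : BesselBound g B) (c : ι → ℂ)
    (s : Finset ι) : ‖∑ i ∈ s, c i • g i‖ ^ 2 ≤ B * ∑ i ∈ s, ‖c i‖ ^ 2 := by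
  set v := ∑ i ∈ s, c i • g i with hv
  have h1 : ‖v‖ ^ 2 ≤ ∑ i ∈ s, ‖c i‖ * ‖inner ℂ (g i) v‖ := by
    have e : inner ℂ v v = ∑ i ∈ s, c i * inner ℂ v (g i) := by
      conv_lhs => rw [hv, inner_sum]
      simp only [inner_smul_right]
      rfl
    calc ‖v‖ ^ 2 = ‖(inner ℂ v v : ℂ)‖ := by
          rw [inner_self_eq_norm_sq_to_K]
          simp
      _ ≤ _ := by
          rw [e]
          refine (norm_sum_le _ _).trans (Finset.sum_le_sum fun i _ => ?_)
          rw [norm_mul, norm_inner_symm]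
  have h2 : (∑ i ∈ s, ‖c i‖ * ‖inner ℂ (g i) v‖) ^ 2 ≤
      (∑ i ∈ s, ‖c i‖ ^ 2) * (B * ‖v‖ ^ 2) := by
    refine (Finset.sum_mul_sq_le_sq_mul_sq s _ _).trans
      (mul_le_mul_of_nonneg_left ?_ (Finset.sum_nonneg fun _ _ => by positivity))
    exact ((h.summable v).sum_le_tsum s fun _ _ => by positivity).trans (h.tsum_le hB v)
  have h3 : (‖v‖ ^ 2) ^ 2 ≤ (∑ i ∈ s, ‖c i‖ ^ 2) * (B * ‖v‖ ^ 2) :=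
    (pow_le_pow_left₀ (by positivity) h1 2).trans h2
  rcases eq_or_ne ‖v‖ 0 with h0 | h0
  · rw [h0]
    have : 0 ≤ ∑ i ∈ s, ‖c i‖ ^ 2 := Finset.sum_nonneg fun _ _ => by positivity
    simpa using mul_nonneg hB this
  · have h4 : 0 < ‖v‖ ^ 2 := by positivity
    nlinarith

theorem BesselBound.summable_smul (hB : 0 ≤ B) (h : BesselBound g B) {c : ι → ℂ}
    (hc : Summable fun i => ‖c i‖ ^ 2) : Summable fun i => c i • g i := by
  rw [summable_iff_vanishing_norm]
  intro ε hε
  obtain ⟨s, hs⟩ := summable_iff_vanishing_norm.1 hc (ε ^ 2 / (B + 1)) (by positivity)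
  refine ⟨s, fun t ht => ?_⟩
  have h1 := (le_abs_self _).trans_lt (hs t ht)
  have h2 := h.norm_sum_smul_sq_le hB c t
  rw [lt_div_iff₀ (by positivity)] at h1
  have h3 : 0 ≤ ∑ i ∈ t, ‖c i‖ ^ 2 := Finset.sum_nonneg fun _ _ => by positivity
  refine lt_of_pow_lt_pow_left₀ 2 hε.le ?_
  nlinarith

theorem summable_expansionTerm (hB : 0 ≤ B) (h : BesselBound g B) (ht : BesselBound gt Bt)
    (f : L2) : Summable (expansionTerm g gt f) :=
  h.summable_smul hB (ht.summable f)

theorem norm_tsum_expansionTerm_le (hB : 0 ≤ B) (hBt : 0 ≤ Bt) (h : BesselBound g B)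
    (ht : BesselBound gt Bt) (f : L2) :
    ‖∑' i, expansionTerm g gt f i‖ ≤ Real.sqrt (B * Bt) * ‖f‖ := by
  have hlim := (summable_expansionTerm hB h ht f).hasSum.norm
  refine le_of_tendsto' hlim fun s => ?_
  refine le_of_sq_le_sq ?_ (by positivity)
  rw [mul_pow, Real.sq_sqrt (mul_nonneg hB hBt), mul_assoc]
  refine (h.norm_sum_smul_sq_le hB (fun i => inner ℂ (gt i) f) s).trans
    (mul_le_mul_of_nonneg_left ?_ hB)
  exact ((ht.summable f).sum_le_tsum s fun _ _ => by positivity).trans (ht.tsum_le hBt f)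

end Bessel

theorem dilate_add {c : ℝ} (hc : 0 < c) (f g : L2) :
    dilate hc (f + g) = dilate hc f + dilate hc g := by
  refine Lp.ext ?_
  filter_upwards [coeFn_dilate hc (f + g), coeFn_dilate hc f, coeFn_dilate hc g,
    Lp.coeFn_add (dilate hc f) (dilate hc g), ae_comp_mul_left hc.ne' (Lp.coeFn_add f g)]
    with x h1 h2 h3 h4 h5
  rw [h1, h4, Pi.add_apply, h2, h3, h5, Pi.add_apply, mul_add]

theorem waveletSystem_add {a : ℝ} (ha : 0 < a) (b : ℝ) (φ χ : L2) (p : ℤ × ℤ) :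
    waveletSystem ha b (φ + χ) p = waveletSystem ha b φ p + waveletSystem ha b χ p := by
  rw [waveletSystem, translate, map_add, dilate_add]
  rfl

/-! ### Dual generators with band-limited symbols -/

theorem integral_inner_dilates {c : ℝ} (hc : 0 < c) (m : ℝ → ℝ) (u v w : ℝ → ℂ) :
    ∫ x, inner ℂ ((starRingEnd ℂ) (u x) * (((Real.sqrt c : ℝ) : ℂ) * w (c * x)))
        ((starRingEnd ℂ) (m x * u x) * (((Real.sqrt c : ℝ) : ℂ) * v (c * x))) =
      ∫ x, ((m (c⁻¹ * x) * ‖u (c⁻¹ * x)‖ ^ 2 : ℝ) : ℂ) * inner ℂ (w x) (v x) := by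
  have h : ∀ x, inner ℂ ((starRingEnd ℂ) (u x) * (((Real.sqrt c : ℝ) : ℂ) * w (c * x)))
        ((starRingEnd ℂ) (m x * u x) * (((Real.sqrt c : ℝ) : ℂ) * v (c * x))) =
      (fun y => (c : ℂ) * (((m (c⁻¹ * y) * ‖u (c⁻¹ * y)‖ ^ 2 : ℝ) : ℂ) * inner ℂ (w y) (v y)))
        (c * x) := by
    intro x
    have hs : ((Real.sqrt c : ℝ) : ℂ) * ((Real.sqrt c : ℝ) : ℂ) = c := by
      rw [← Complex.ofReal_mul, Real.mul_self_sqrt hc.le]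
    have hu : (starRingEnd ℂ) (u x) * u x = ((‖u x‖ ^ 2 : ℝ) : ℂ) := by
      rw [Complex.conj_mul']
      push_cast
      rfl
    simp only [RCLike.inner_apply, map_mul, Complex.conj_conj, Complex.conj_ofReal,
      inv_mul_cancel_left₀ hc.ne']
    push_cast at hu ⊢
    rw [← hu, ← hs]
    ring
  simp_rw [h]
  rw [Measure.integral_comp_mul_left (fun y =>
    (c : ℂ) * (((m (c⁻¹ * y) * ‖u (c⁻¹ * y)‖ ^ 2 : ℝ) : ℂ) * inner ℂ (w y) (v y))),
    integral_const_mul, abs_of_pos (inv_pos.2 hc), Complex.real_smul, ← mul_assoc,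
    ← Complex.ofReal_mul, inv_mul_cancel₀ hc.ne', Complex.ofReal_one, one_mul]

/-- If `φ̂ = u` and the Fourier transform of `φt` is `m u` with `m ≥ 0`, where `u` is supported in
`[-κ, κ]` with `2κ < 1/b`, and if `∑ⱼ m(a^j γ)|u(a^j γ)|² = b`, then the two wavelet systems are
dual. -/
theorem tsum_expansionTerm_eq_self {a : ℝ} (ha : 0 < a) {b : ℝ} (hb : 0 < b) (φ φt : L2)
    {u : ℝ → ℂ} {m : ℝ → ℝ} (hum : Measurable u) (hmm : Measurable m) (hm0 : ∀ x, 0 ≤ m x)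
    (hu : (𝓕 φ : L2) =ᵐ[volume] u) (hut : (𝓕 φt : L2) =ᵐ[volume] fun x => m x * u x)
    {c ct : ℝ} (hc : ∀ x, ‖u x‖ ≤ c) (hct : ∀ x, ‖(m x : ℂ) * u x‖ ≤ ct) {κ : ℝ}
    (hκ : 2 * κ < 1 / b) (hsupp : ∀ x, κ < |x| → u x = 0)
    (hsum : ∀ᵐ γ : ℝ, HasSum (fun j : ℤ => m (a ^ j * γ) * ‖u (a ^ j * γ)‖ ^ 2) b)
    {B Bt : ℝ} (hB0 : 0 ≤ B) (hB : BesselBound (waveletSystem ha b φ) B)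
    (hBt : BesselBound (waveletSystem ha b φt) Bt) (f : L2) :
    ∑' p, expansionTerm (waveletSystem ha b φ) (waveletSystem ha b φt) f p = f := by
  refine ext_inner_left ℂ fun h => ?_
  have hS := (summable_expansionTerm hB0 hB hBt f).hasSum
  have hS1 := (innerSL ℂ h).hasSum hS
  have hfib : ∀ j : ℤ, HasSum (fun k : ℤ => innerSL ℂ h (expansionTerm (waveletSystem ha b φ)
      (waveletSystem ha b φt) f (j, k))) (((1 / b : ℝ) : ℂ) *
        ∫ x, ((m (a ^ (-j) * x) * ‖u (a ^ (-j) * x)‖ ^ 2 : ℝ) : ℂ) *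
          inner ℂ ((𝓕 h : L2) x) ((𝓕 f : L2) x)) := by
    intro j
    have hj := zpow_pos ha j
    have hout : ∀ x, x ∉ Set.Ioc (-(1 / b) / 2) (-(1 / b) / 2 + 1 / b) → u x = 0 := fun x hx =>
      hsupp x (by
        by_contra hle
        rw [not_lt, abs_le] at hle
        exact hx ⟨by linarith, by linarith⟩)
    have hP := hasSum_inner_integral_expChar hb (-(1 / b) / 2)
      (memLp_conj_mul hum hc (memLp_dilate_of_ae hj (𝓕 h) ae_eq_rfl))
      (memLp_conj_mul ((Complex.measurable_ofReal.comp hmm).mul hum) hct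
        (memLp_dilate_of_ae hj (𝓕 f) ae_eq_rfl))
      (fun x hx => by simp [hout x hx]) (fun x hx => by simp [hout x hx])
    simp only [Pi.mul_apply, Function.comp_apply] at hP
    rw [integral_inner_dilates hj, ← zpow_neg] at hP
    convert! hP using 2 with k
    rw [innerSL_apply_apply, expansionTerm, inner_smul_right,
      inner_waveletSystem ha b φt f hut ae_eq_rfl, ← inner_conj_symm h,
      inner_waveletSystem ha b φ h hu ae_eq_rfl, RCLike.inner_apply]
    rfl
  have hS2 := (hS1.prod_fiberwise hfib).tsum_eq
  rw [innerSL_apply_apply] at hS2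
  rw [← hS2, tsum_mul_left]
  -- The sum over the scales is taken inside the integral, where it produces the constant `b`.
  have hq : ∀ᵐ γ : ℝ, HasSum (fun j : ℤ => m (a ^ (-j) * γ) * ‖u (a ^ (-j) * γ)‖ ^ 2) b := by
    filter_upwards [hsum] with γ hγ
    exact (Equiv.neg ℤ).hasSum_iff.2 hγ
  have hint : Integrable fun x => (inner ℂ ((𝓕 h : L2) x) ((𝓕 f : L2) x) : ℂ) :=
    L2.integrable_inner (𝕜 := ℂ) (𝓕 h : L2) (𝓕 f : L2)
  have hqm : ∀ j : ℤ, Measurable fun x => ((m (a ^ (-j) * x) * ‖u (a ^ (-j) * x)‖ ^ 2 : ℝ) : ℂ) :=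
    fun j => Complex.measurable_ofReal.comp ((hmm.comp (measurable_const_mul _)).mul
      ((hum.comp (measurable_const_mul _)).norm.pow_const 2))
  rw [← integral_tsum]
  · rw [← Lp.inner_fourier_eq, L2.inner_def, ← integral_const_mul]
    refine integral_congr_ae ?_
    filter_upwards [hq] with γ hγ
    have hγ' := Complex.hasSum_ofReal.2 hγ
    rw [tsum_mul_right, hγ'.tsum_eq, ← mul_assoc, ← Complex.ofReal_mul, one_div,
      inv_mul_cancel₀ hb.ne', Complex.ofReal_one, one_mul]
  · exact fun j => (hqm j).aestronglyMeasurable.mul hint.1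
  · have hmeas : ∀ j : ℤ, AEMeasurable fun x =>
        ‖((m (a ^ (-j) * x) * ‖u (a ^ (-j) * x)‖ ^ 2 : ℝ) : ℂ) *
          inner ℂ ((𝓕 h : L2) x) ((𝓕 f : L2) x)‖ₑ := fun j =>
      ((hqm j).aestronglyMeasurable.mul hint.1).enorm
    rw [← lintegral_tsum hmeas]
    refine ne_of_lt (lt_of_le_of_lt (b := ∫⁻ x, ENNReal.ofReal b *
      ‖(inner ℂ ((𝓕 h : L2) x) ((𝓕 f : L2) x) : ℂ)‖ₑ) (lintegral_mono_ae ?_) ?_)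
    · filter_upwards [hq] with γ hγ
      have h1 : ∑' j : ℤ, ‖((m (a ^ (-j) * γ) * ‖u (a ^ (-j) * γ)‖ ^ 2 : ℝ) : ℂ)‖ₑ =
          ENNReal.ofReal b := by
        rw [← hγ.tsum_eq, ENNReal.ofReal_tsum_of_nonneg
          (fun j => mul_nonneg (hm0 _) (by positivity)) hγ.summable]
        refine tsum_congr fun j => ?_
        rw [← ofReal_norm, Complex.norm_real, Real.norm_of_nonneg
          (mul_nonneg (hm0 _) (by positivity))]
      simp_rw [enorm_mul]
      rw [ENNReal.tsum_mul_right, h1]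
    · rw [lintegral_const_mul' _ _ ENNReal.ofReal_ne_top]
      exact ENNReal.mul_lt_top ENNReal.ofReal_lt_top hint.2

/-! ### The oversampling factor and the error bound -/

theorem existsUnique_isOversamplingFactor (b : ℝ) (K : ℕ) :
    ∃! N : ℤ, IsOversamplingFactor b K N := by
  have h1 := Int.floor_le ((2 * b * K + 1) / 2)
  have h2 := Int.lt_floor_add_one ((2 * b * K + 1) / 2)
  refine ⟨2 * ⌊(2 * b * K + 1) / 2⌋ + 1, ⟨odd_two_mul_add_one _, ?_, ?_⟩, ?_⟩
  · push_cast
    linarith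
  · push_cast
    linarith
  · rintro N ⟨⟨m, rfl⟩, h3, h4⟩
    push_cast at h3 h4
    have : ⌊(2 * b * K + 1) / 2⌋ = m := by
      rw [Int.floor_eq_iff]
      constructor <;> linarith
    rw [this]

theorem errorBound_nonneg {a b C σ : ℝ} (hC : 0 ≤ C) (K : ℕ) : 0 ≤ errorBound a b C σ K := by
  unfold errorBound
  positivity

theorem errorBound_sq {a b C σ : ℝ} (ha : 1 < a) (hb : 0 < b) (hσ : 0 < σ) (K : ℕ) :
    errorBound a b C σ K ^ 2 = ((K : ℝ) + 1 / b) / (K : ℝ) ^ (3 + 2 * σ) * (2 * C) ^ 2 *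
      ((1 + 1 / (2 * σ)) * (a ^ (1 + σ) / (a ^ (1 + σ) - 1))) := by
  have h1 : 0 < a ^ (1 + σ) - 1 := sub_pos.2 (Real.one_lt_rpow ha (by linarith))
  have h0 : 0 < a := by linarith
  rw [errorBound, mul_pow, mul_pow, Real.sq_sqrt (by positivity), Real.sq_sqrt (by positivity)]

/-- The Bessel bound of the tail, up to the factor `1/b`, is at most `ε_K² / 2`. -/
theorem tail_bound_le_errorBound {a b C σ : ℝ} (ha : 1 < a) (hb : 0 < b) (hσ : 0 < σ) {K : ℕ}
    (hK : 1 ≤ K) :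
    2 * (C * (K : ℝ) ^ (-(1 + σ)) * (1 + 1 / (2 * σ))) *
      (C * (K : ℝ) ^ (-(1 + σ)) * (a ^ (1 + σ) / (a ^ (1 + σ) - 1))) ≤
      errorBound a b C σ K ^ 2 / 2 := by
  have h1 : 0 < a ^ (1 + σ) - 1 := sub_pos.2 (Real.one_lt_rpow ha (by linarith))
  have h0 : 0 < a := by linarith
  have hK0 : (0 : ℝ) < K := by exact_mod_cast hK
  have hpow : (K : ℝ) ^ (3 + 2 * σ) = K * ((K : ℝ) ^ (1 + σ)) ^ 2 := by
    rw [← Real.rpow_natCast, ← Real.rpow_mul hK0.le]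
    nth_rewrite 2 [← Real.rpow_one (K : ℝ)]
    rw [← Real.rpow_add hK0]
    congr 1
    push_cast
    ring
  rw [errorBound_sq ha hb hσ, hpow, Real.rpow_neg hK0.le]
  set q := (K : ℝ) ^ (1 + σ)
  have hq : 0 < q := by positivity
  set r := a ^ (1 + σ) / (a ^ (1 + σ) - 1)
  have hr : 0 < r := by positivity
  have e1 : 2 * (C * q⁻¹ * (1 + 1 / (2 * σ))) * (C * q⁻¹ * r) =
      1 * (2 * C ^ 2 * (q⁻¹) ^ 2 * (1 + 1 / (2 * σ)) * r) := by ring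
  have e2 : ((K : ℝ) + 1 / b) / (K * q ^ 2) * (2 * C) ^ 2 * ((1 + 1 / (2 * σ)) * r) / 2 =
      (((K : ℝ) + 1 / b) / K) * (2 * C ^ 2 * (q⁻¹) ^ 2 * (1 + 1 / (2 * σ)) * r) := by
    field_simp
  rw [e1, e2]
  refine mul_le_mul_of_nonneg_right ?_ (by positivity)
  rw [one_le_div hK0]
  have : 0 < 1 / b := by positivity
  linarith

/-- The same quantity dominates the Calderón sum of the tail. -/
theorem tail_calderon_le_errorBound {a b C σ : ℝ} (ha : 1 < a) (hb : 0 < b) (hC : 0 ≤ C)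
    (hσ : 0 < σ) {K : ℕ} (hK : 1 ≤ K) :
    C * (K : ℝ) ^ (-(1 + σ)) * (C * (K : ℝ) ^ (-(1 + σ)) * (a ^ (1 + σ) / (a ^ (1 + σ) - 1))) ≤
      errorBound a b C σ K ^ 2 / 2 := by
  refine le_trans ?_ (tail_bound_le_errorBound ha hb hσ hK)
  have h1 : 0 < a ^ (1 + σ) - 1 := sub_pos.2 (Real.one_lt_rpow ha (by linarith))
  have h0 : 0 < a := by linarith
  refine mul_le_mul_of_nonneg_right ?_ (by positivity)
  have h2 : 0 ≤ C * (K : ℝ) ^ (-(1 + σ)) := by positivity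
  have h3 : 0 < 1 / (2 * σ) := by positivity
  nlinarith

theorem tendsto_errorBound {a b C σ : ℝ} (hσ : 0 < σ) :
    Tendsto (fun K : ℕ => errorBound a b C σ K) atTop (𝓝 0) := by
  have h1 : Tendsto (fun x : ℝ => x ^ (-(2 + 2 * σ)) + 1 / b * x ^ (-(3 + 2 * σ))) atTop (𝓝 0) := by
    simpa using (tendsto_rpow_neg_atTop (by linarith : 0 < 2 + 2 * σ)).add
      ((tendsto_rpow_neg_atTop (by linarith : 0 < 3 + 2 * σ)).const_mul (1 / b))
  have h2 : Tendsto (fun x : ℝ => (x + 1 / b) / x ^ (3 + 2 * σ)) atTop (𝓝 0) := by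
    refine h1.congr' ?_
    filter_upwards [eventually_gt_atTop 0] with x hx
    rw [add_div, Real.rpow_neg hx.le (3 + 2 * σ), div_eq_mul_inv (1 / b)]
    congr 1
    nth_rewrite 2 [← Real.rpow_one x]
    rw [← Real.rpow_sub hx]
    congr 1
    ring
  have h3 := ((Real.continuous_sqrt.tendsto 0).comp (h2.comp tendsto_natCast_atTop_atTop))
  rw [Real.sqrt_zero] at h3
  have h4 := (h3.mul_const (2 * C)).mul_const
    (Real.sqrt ((1 + 1 / (2 * σ)) * (a ^ (1 + σ) / (a ^ (1 + σ) - 1))))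
  simpa [errorBound] using h4

/-! ### The truncated generator and its dual -/

theorem fourier_truncation (ψ : L2) (K : ℝ) {u : ℝ → ℂ} (hu : (𝓕 ψ : L2) =ᵐ[volume] u) :
    (𝓕 (truncation ψ K) : L2) =ᵐ[volume] (Set.Icc (-K) K).indicator u := by
  rw [truncation, FourierTransform.fourier_fourierInv_eq]
  exact (MemLp.coeFn_toLp _).trans (hu.indicator)

theorem fourier_sub_truncation (ψ : L2) (K : ℝ) {u : ℝ → ℂ} (hu : (𝓕 ψ : L2) =ᵐ[volume] u) :
    (𝓕 (ψ - truncation ψ K) : L2) =ᵐ[volume] {x | K < |x|}.indicator u := by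
  have h : 𝓕 (ψ - truncation ψ K) = (𝓕 ψ : L2) - 𝓕 (truncation ψ K) :=
    (Lp.fourierTransformₗᵢ ℝ ℂ).map_sub _ _
  rw [h]
  filter_upwards [Lp.coeFn_sub (𝓕 ψ : L2) (𝓕 (truncation ψ K)), hu, fourier_truncation ψ K hu]
    with x h1 h2 h3
  rw [h1, Pi.sub_apply, h2, h3]
  by_cases hx : |x| ≤ K
  · rw [Set.indicator_of_mem (show x ∈ Set.Icc (-K) K from abs_le.1 hx),
      Set.indicator_of_notMem (show x ∉ {x | K < |x|} from not_lt.2 hx), sub_self]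
  · rw [Set.indicator_of_notMem (show x ∉ Set.Icc (-K) K from fun h => hx (abs_le.2 h)),
      Set.indicator_of_mem (show x ∈ {x | K < |x|} from not_le.1 hx), sub_zero]

/-- The truncated symbol and the tail have disjoint supports. -/
theorem enorm_sq_eq_add_indicator (u : ℝ → ℂ) (K x : ℝ) :
    ‖u x‖ₑ ^ 2 = ‖(Set.Icc (-K) K).indicator u x‖ₑ ^ 2 + ‖{x | K < |x|}.indicator u x‖ₑ ^ 2 := by
  by_cases hx : |x| ≤ K
  · rw [Set.indicator_of_mem (show x ∈ Set.Icc (-K) K from abs_le.1 hx),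
      Set.indicator_of_notMem (show x ∉ {x | K < |x|} from not_lt.2 hx)]
    simp
  · rw [Set.indicator_of_notMem (show x ∉ Set.Icc (-K) K from fun h => hx (abs_le.2 h)),
      Set.indicator_of_mem (show x ∈ {x | K < |x|} from not_le.1 hx)]
    simp

theorem summable_sq_of_tsum_enorm_le {ι : Type*} {f : ι → ℂ} {c : ℝ}
    (h : ∑' i, ‖f i‖ₑ ^ 2 ≤ ENNReal.ofReal c) : Summable fun i => ‖f i‖ ^ 2 := by
  have h1 : ∑' i, ENNReal.ofReal (‖f i‖ ^ 2) ≠ ⊤ := by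
    simp_rw [← enorm_sq_eq_ofReal]
    exact (h.trans_lt ENNReal.ofReal_lt_top).ne
  simpa only [ENNReal.toReal_ofReal (sq_nonneg ‖_‖)] using ENNReal.summable_toReal h1

theorem IsTail.tsum_dilates_sq_le {u : ℝ → ℂ} {C s κ a : ℝ} (h : IsTail u C s κ) (hC : 0 ≤ C)
    (hs : 0 < s) (hκ : 0 < κ) (ha : 1 < a) (γ : ℝ) :
    ∑' j : ℤ, ‖u (a ^ j * γ)‖ₑ ^ 2 ≤
      ENNReal.ofReal (C * κ ^ (-s) * (C * κ ^ (-s) * (a ^ s / (a ^ s - 1)))) := by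
  rw [ENNReal.ofReal_mul (by positivity)]
  refine le_trans (ENNReal.tsum_le_tsum fun j => ?_)
    (ENNReal.tsum_mul_left.trans_le (mul_le_mul_right (h.tsum_dilates_le hC hs hκ ha γ) _))
  rw [sq]
  exact mul_le_mul_left (h.enorm_le hC hs.le hκ _) _

/-- The sum `∑ⱼ |u(a^j γ)|²` of a symbol `u`. -/
def symbolSum (a : ℝ) (u : ℝ → ℂ) (γ : ℝ) : ℝ :=
  ∑' j : ℤ, ‖u (a ^ j * γ)‖ ^ 2

theorem measurable_symbolSum (a : ℝ) {u : ℝ → ℂ} (hu : Measurable u) :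
    Measurable (symbolSum a u) :=
  Measurable.tsum fun _ => (hu.comp (measurable_const_mul _)).norm.pow_const 2

theorem symbolSum_zpow_mul {a : ℝ} (ha : 0 < a) (u : ℝ → ℂ) (j : ℤ) (γ : ℝ) :
    symbolSum a u (a ^ j * γ) = symbolSum a u γ := by
  rw [symbolSum, symbolSum, ← (Equiv.addRight j).tsum_eq (fun k : ℤ => ‖u (a ^ k * γ)‖ ^ 2)]
  refine tsum_congr fun k => ?_
  rw [Equiv.coe_addRight, zpow_add₀ ha.ne', mul_assoc]

theorem ae_comp_zpow_mul_eq {a : ℝ} (ha : 0 < a) (φ : L2) {u : ℝ → ℂ}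
    (hu : (𝓕 φ : L2) =ᵐ[volume] u) :
    ∀ᵐ γ : ℝ, ∀ k : ℤ, (𝓕 φ : L2) (a ^ k * γ) = u (a ^ k * γ) :=
  ae_all_iff.2 fun k => ae_comp_mul_left (zpow_pos ha k).ne' hu

theorem ae_calderonSum_eq {a : ℝ} (ha : 0 < a) (φ : L2) {u : ℝ → ℂ}
    (hu : (𝓕 φ : L2) =ᵐ[volume] u) : ∀ᵐ γ : ℝ, calderonSum a φ γ = symbolSum a u γ := by
  filter_upwards [ae_comp_zpow_mul_eq ha φ hu] with γ hγ
  simp only [calderonSum, symbolSum, hγ]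

/-- A representative of the Fourier transform that satisfies the decay condition everywhere. -/
theorem exists_symbol (ψ : L2) {C σ : ℝ} (hC : 0 ≤ C)
    (hdecay : ∀ᵐ γ : ℝ, ‖(𝓕 ψ : L2) γ‖ ≤ C / (1 + |γ| ^ (1 + σ))) :
    ∃ u : ℝ → ℂ, Measurable u ∧ (𝓕 ψ : L2) =ᵐ[volume] u ∧ (∀ x, ‖u x‖ ≤ C) ∧
      ∀ x, x ≠ 0 → ‖u x‖ ≤ C * |x| ^ (-(1 + σ)) := by
  have hm : Measurable (𝓕 ψ : L2) := (Lp.stronglyMeasurable _).measurable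
  have hbd : Measurable fun γ : ℝ => C / (1 + |γ| ^ (1 + σ)) := by fun_prop
  have hD : MeasurableSet {γ : ℝ | ‖(𝓕 ψ : L2) γ‖ ≤ C / (1 + |γ| ^ (1 + σ))} :=
    measurableSet_le hm.norm hbd
  have hu : ∀ x, ‖{γ : ℝ | ‖(𝓕 ψ : L2) γ‖ ≤ C / (1 + |γ| ^ (1 + σ))}.indicator (𝓕 ψ : L2) x‖ ≤
      C / (1 + |x| ^ (1 + σ)) := by
    intro x
    by_cases hx : x ∈ {γ : ℝ | ‖(𝓕 ψ : L2) γ‖ ≤ C / (1 + |γ| ^ (1 + σ))}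
    · rw [Set.indicator_of_mem hx]
      exact hx
    · rw [Set.indicator_of_notMem hx, norm_zero]
      positivity
  refine ⟨_, hm.indicator hD, ?_, fun x => (hu x).trans ?_, fun x hx => (hu x).trans ?_⟩
  · filter_upwards [hdecay] with x hx
    exact (Set.indicator_of_mem (s := {γ : ℝ | ‖(𝓕 ψ : L2) γ‖ ≤ C / (1 + |γ| ^ (1 + σ))}) hx _).symm
  · refine div_le_self hC ?_
    have : 0 ≤ |x| ^ (1 + σ) := by positivity
    linarith
  · have h0 : 0 < |x| := abs_pos.2 hx
    rw [Real.rpow_neg h0.le, ← div_eq_mul_inv]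
    exact div_le_div_of_nonneg_left hC (by positivity) (by linarith)

/-- The Calderón sum of the truncated symbol lies between `bA - ε²/2` and `bB`, because truncation
removes exactly the Calderón sum of the tail. -/
theorem ae_symbolSum_truncated_bounds {a : ℝ} (ha : 1 < a) {b : ℝ} (hb : 0 < b) (ψ : L2)
    {u : ℝ → ℂ} (hum : Measurable u) (hu : (𝓕 ψ : L2) =ᵐ[volume] u) {C σ : ℝ} (hC0 : 0 ≤ C)
    (hσ : 0 < σ) (hC : ∀ x, ‖u x‖ ≤ C) (hdecay : ∀ x, x ≠ 0 → ‖u x‖ ≤ C * |x| ^ (-(1 + σ)))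
    {A B : ℝ}
    (hA : ∀ f : L2, ENNReal.ofReal A * ‖f‖ₑ ^ 2 ≤
      ∑' p, ‖inner ℂ (waveletSystem (zero_lt_one.trans ha) b ψ p) f‖ₑ ^ 2)
    (hB : BesselBound (waveletSystem (zero_lt_one.trans ha) b ψ) B) {K : ℕ} (hK : 1 ≤ K) {δ : ℝ}
    (hδ : 0 < δ) (hδA : δ + errorBound a b C σ K ^ 2 / 2 = b * A) :
    ∀ᵐ γ : ℝ, Summable (fun j : ℤ => ‖(Set.Icc (-(K : ℝ)) K).indicator u (a ^ j * γ)‖ ^ 2) ∧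
      δ ≤ symbolSum a ((Set.Icc (-(K : ℝ)) K).indicator u) γ ∧
      ∑' j : ℤ, ‖(Set.Icc (-(K : ℝ)) K).indicator u (a ^ j * γ)‖ₑ ^ 2 ≤
        ENNReal.ofReal (b * B) := by
  have hK0 : (0 : ℝ) < K := by exact_mod_cast hK
  filter_upwards [calderon_le ha hb ψ hum hu hC hB,
    le_calderon ha hb ψ hum hu hC0 hσ hC hdecay hA] with γ h1 h2
  have htail := ((isTail_indicator hdecay hK0).tsum_dilates_sq_le hC0 (by linarith : 0 < 1 + σ)
    hK0 ha γ).trans (ENNReal.ofReal_le_ofReal (tail_calderon_le_errorBound ha hb hC0 hσ hK))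
  simp_rw [enorm_sq_eq_add_indicator u K] at h1 h2
  rw [ENNReal.tsum_add] at h1 h2
  have hle := le_self_add.trans h1
  have hs := summable_sq_of_tsum_enorm_le hle
  refine ⟨hs, ?_, hle⟩
  have h3 := h2.trans (add_le_add_right htail _)
  rw [← hδA, ENNReal.ofReal_add hδ.le (by positivity)] at h3
  have h4 := (ENNReal.add_le_add_iff_right ENNReal.ofReal_ne_top).1 h3
  rw [tsum_enorm_sq_eq_ofReal hs.hasSum] at h4
  exact (ENNReal.ofReal_le_ofReal_iff (tsum_nonneg fun _ => by positivity)).1 h4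

/-- The multiplier `b / ∑ⱼ |u(a^j γ)|²` relating a symbol `u` to the symbol of its dual. The
denominator is cut off at `δ`, which changes the function only on a null set when the sum is at
least `δ` almost everywhere. -/
def dualMultiplier (a b δ : ℝ) (u : ℝ → ℂ) (γ : ℝ) : ℝ :=
  b / max (symbolSum a u γ) δ

section dualMultiplier

variable {a b δ : ℝ} {u : ℝ → ℂ}

theorem measurable_dualMultiplier (hu : Measurable u) :
    Measurable (dualMultiplier a b δ u) :=
  measurable_const.div ((measurable_symbolSum a hu).max measurable_const)

theorem dualMultiplier_nonneg (hb : 0 ≤ b) (hδ : 0 < δ) (γ : ℝ) :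
    0 ≤ dualMultiplier a b δ u γ :=
  div_nonneg hb (hδ.le.trans (le_max_right _ _))

theorem dualMultiplier_le (hb : 0 ≤ b) (hδ : 0 < δ) (γ : ℝ) :
    dualMultiplier a b δ u γ ≤ b / δ :=
  div_le_div_of_nonneg_left hb hδ (le_max_right _ _)

theorem norm_dualMultiplier_mul_le (hb : 0 ≤ b) (hδ : 0 < δ) {C : ℝ} (hC : ∀ x, ‖u x‖ ≤ C)
    (x : ℝ) : ‖(dualMultiplier a b δ u x : ℂ) * u x‖ ≤ b / δ * C := by
  rw [norm_mul, Complex.norm_real, Real.norm_of_nonneg (dualMultiplier_nonneg hb hδ x)]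
  exact mul_le_mul (dualMultiplier_le hb hδ x) (hC x) (norm_nonneg _) (div_nonneg hb hδ.le)

theorem dualMultiplier_zpow_mul (ha : 0 < a) {γ : ℝ} (h : δ ≤ symbolSum a u γ) (j : ℤ) :
    dualMultiplier a b δ u (a ^ j * γ) = b / symbolSum a u γ := by
  rw [dualMultiplier, symbolSum_zpow_mul ha, max_eq_left h]

theorem hasSum_dualMultiplier (ha : 0 < a) (hδ : 0 < δ) {γ : ℝ}
    (hs : Summable fun j : ℤ => ‖u (a ^ j * γ)‖ ^ 2) (h : δ ≤ symbolSum a u γ) :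
    HasSum (fun j : ℤ => dualMultiplier a b δ u (a ^ j * γ) * ‖u (a ^ j * γ)‖ ^ 2) b := by
  simp_rw [dualMultiplier_zpow_mul ha h]
  have h1 := hs.hasSum.mul_left (b / symbolSum a u γ)
  change HasSum _ (b / symbolSum a u γ * symbolSum a u γ) at h1
  rwa [div_mul_cancel₀ b (hδ.trans_le h).ne'] at h1

theorem tsum_enorm_dualMultiplier_mul_sq_le (ha : 0 < a) (hb : 0 ≤ b) (hδ : 0 < δ) {γ : ℝ}
    (hs : Summable fun j : ℤ => ‖u (a ^ j * γ)‖ ^ 2) (h : δ ≤ symbolSum a u γ) :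
    ∑' j : ℤ, ‖(dualMultiplier a b δ u (a ^ j * γ) : ℂ) * u (a ^ j * γ)‖ₑ ^ 2 ≤
      ENNReal.ofReal (b * (b / δ)) := by
  have h1 : HasSum (fun j : ℤ => ‖(dualMultiplier a b δ u (a ^ j * γ) : ℂ) * u (a ^ j * γ)‖ ^ 2)
      (b * (b / symbolSum a u γ)) := by
    have h2 := (hasSum_dualMultiplier (b := b) ha hδ hs h).mul_right (b / symbolSum a u γ)
    refine h2.congr_fun fun j => ?_
    rw [norm_mul, Complex.norm_real, mul_pow, Real.norm_eq_abs, sq_abs,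
      dualMultiplier_zpow_mul ha h]
    ring
  rw [tsum_enorm_sq_eq_ofReal h1]
  exact ENNReal.ofReal_le_ofReal (mul_le_mul_of_nonneg_left
    (div_le_div_of_nonneg_left hb hδ h) hb)

end dualMultiplier

theorem ae_dualSymbol_eq {a : ℝ} (ha : 0 < a) (b : ℝ) (N : ℤ) (φ : L2) {u : ℝ → ℂ}
    (hu : (𝓕 φ : L2) =ᵐ[volume] u) {δ : ℝ} (h : ∀ᵐ γ : ℝ, δ ≤ symbolSum a u γ) :
    dualSymbol a b N φ =ᵐ[volume] fun γ => (dualMultiplier a (b / N) δ u γ : ℂ) * u γ := by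
  filter_upwards [ae_calderonSum_eq ha φ hu, hu, h] with γ h1 h2 h3
  rw [dualSymbol, h1, h2, dualMultiplier, max_eq_left h3, mul_comm (b : ℂ), mul_div_assoc, mul_comm]
  congr 1
  push_cast
  rw [div_div]

theorem sqrt_div_sub_le {ε s : ℝ} (hε : 0 ≤ ε) (hs : ε < s) :
    Real.sqrt (ε ^ 2 / 2 / (s ^ 2 / 2 - ε ^ 2 / 2)) ≤ ε / (s - ε) := by
  have h1 : 0 < s - ε := sub_pos.2 hs
  refine Real.sqrt_le_iff.2 ⟨div_nonneg hε h1.le, ?_⟩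
  have e : ε ^ 2 / 2 / (s ^ 2 / 2 - ε ^ 2 / 2) = ε ^ 2 / ((s - ε) * (s + ε)) := by
    rw [← sub_div, div_div_div_cancel_right₀ two_ne_zero]
    congr 1
    ring
  rw [e, div_pow]
  refine div_le_div_of_nonneg_left (sq_nonneg ε) (pow_pos h1 2) ?_
  rw [sq]
  exact mul_le_mul_of_nonneg_left (by linarith) h1.le

/-- If `gt` is dual to `gK`, then it is dual to the perturbation `gK + gR` up to an error
controlled by the Bessel bounds of `gt` and `gR`. -/
theorem norm_sub_tsum_expansionTerm_le {ι : Type*} {gK gR gt : ι → L2} {BK BR Bt : ℝ}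
    (hK0 : 0 ≤ BK) (hR0 : 0 ≤ BR) (ht0 : 0 ≤ Bt) (hK : BesselBound gK BK)
    (hR : BesselBound gR BR) (ht : BesselBound gt Bt) (f : L2)
    (hdual : ∑' i, expansionTerm gK gt f i = f) :
    Summable (expansionTerm (fun i => gK i + gR i) gt f) ∧
      ‖f - ∑' i, expansionTerm (fun i => gK i + gR i) gt f i‖ ≤ Real.sqrt (BR * Bt) * ‖f‖ := by
  have hsK := summable_expansionTerm hK0 hK ht f
  have hsR := summable_expansionTerm hR0 hR ht f
  have hadd : expansionTerm (fun i => gK i + gR i) gt f =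
      fun i => expansionTerm gK gt f i + expansionTerm gR gt f i := by
    funext i
    exact smul_add _ _ _
  rw [hadd]
  refine ⟨hsK.add hsR, ?_⟩
  rw [hsK.tsum_add hsR, hdual, sub_add_cancel_left, norm_neg]
  exact norm_tsum_expansionTerm_le hR0 ht0 hR ht f

end WaveletFrames

end

theorem mainTheorem1 {a b : ℝ} (ha : 1 < a) (hb : 0 < b) (ψ : WaveletFrames.L2) (A : ℝ)
    (hframe : WaveletFrames.IsFrameWithLowerBound
      (WaveletFrames.waveletSystem (zero_lt_one.trans ha) b ψ) A)
    (C σ : ℝ) (hC : 0 < C) (hσ : 0 < σ)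
    (hdecay : ∀ᵐ γ : ℝ, ‖(𝓕 ψ : WaveletFrames.L2) γ‖ ≤ C / (1 + |γ| ^ (1 + σ))) :
    -- the oversampling factor is well defined
    (∀ K : ℕ, 1 ≤ K → ∃! N : ℤ, WaveletFrames.IsOversamplingFactor b K N) ∧
    (∀ K : ℕ, 1 ≤ K → ∀ N : ℤ, WaveletFrames.IsOversamplingFactor b K N →
      WaveletFrames.errorBound a b C σ K < Real.sqrt (2 * b * A) →
      -- the formula for the Fourier transform of the dual generator is meaningful
      (∀ᵐ γ : ℝ, Summable (fun k : ℤ =>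
          ‖(𝓕 (WaveletFrames.truncation ψ K) : WaveletFrames.L2) (a ^ k * γ)‖ ^ 2) ∧
        0 < WaveletFrames.calderonSum a (WaveletFrames.truncation ψ K) γ) ∧
      ∃ h : MemLp (WaveletFrames.dualSymbol a b N (WaveletFrames.truncation ψ K)) 2 volume,
        let g := WaveletFrames.waveletSystem (zero_lt_one.trans ha) (b / N) ψ
        let gt := WaveletFrames.waveletSystem (zero_lt_one.trans ha) (b / N)
          (WaveletFrames.dualGenerator h)
        WaveletFrames.IsBessel g ∧ WaveletFrames.IsBessel gt ∧
        (∀ f : WaveletFrames.L2, Summable (WaveletFrames.expansionTerm g gt f) ∧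
          ‖f - ∑' p, WaveletFrames.expansionTerm g gt f p‖ ≤
            WaveletFrames.errorBound a b C σ K /
              (Real.sqrt (2 * b * A) - WaveletFrames.errorBound a b C σ K) * ‖f‖) ∧
        (WaveletFrames.errorBound a b C σ K /
            (Real.sqrt (2 * b * A) - WaveletFrames.errorBound a b C σ K) < 1 →
          WaveletFrames.ApproximatelyDual g gt)) ∧
    Tendsto (fun K : ℕ => WaveletFrames.errorBound a b C σ K) atTop (𝓝 0) := by
  open WaveletFrames in
  refine ⟨fun K _ => existsUnique_isOversamplingFactor b K, ?_, tendsto_errorBound hσ⟩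
  intro K hK N hN hε
  obtain ⟨-, -, hN⟩ := hN
  obtain ⟨hA0, hBessel, hlow⟩ := hframe
  obtain ⟨B, hB0, hB⟩ := hBessel.exists_besselBound
  have ha0 : 0 < a := zero_lt_one.trans ha
  have hA : ∀ f : L2, ENNReal.ofReal A * ‖f‖ₑ ^ 2 ≤
      ∑' p, ‖inner ℂ (waveletSystem (zero_lt_one.trans ha) b ψ p) f‖ₑ ^ 2 := by
    intro f
    rw [tsum_enorm_sq_eq_ofReal (hB.summable f).hasSum, enorm_sq_eq_ofReal,
      ← ENNReal.ofReal_mul hA0.le]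
    exact ENNReal.ofReal_le_ofReal (hlow f)
  obtain ⟨u, hum, hu, huC, hudecay⟩ := exists_symbol ψ hC.le hdecay
  have hK0 : (0 : ℝ) < K := by exact_mod_cast hK
  have hN0 : (0 : ℝ) < N := lt_trans (by positivity) hN
  have hb' : 0 < b / N := div_pos hb hN0
  have hκ : 2 * (K : ℝ) < 1 / (b / N) := by
    rw [one_div_div, lt_div_iff₀ hb]
    linarith
  -- `δ` is the lower bound of the Calderón sum of the truncated generator.
  have hε0 : 0 ≤ errorBound a b C σ K := errorBound_nonneg hC.le K
  have hs2 : Real.sqrt (2 * b * A) ^ 2 = 2 * b * A := Real.sq_sqrt (by positivity)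
  obtain ⟨δ, hδA⟩ : ∃ δ, δ + errorBound a b C σ K ^ 2 / 2 = b * A := ⟨_, sub_add_cancel _ _⟩
  have hδ : 0 < δ := by
    have := pow_lt_pow_left₀ hε hε0 two_ne_zero
    rw [hs2] at this
    linarith
  have hbounds := ae_symbolSum_truncated_bounds ha hb ψ hum hu hC.le hσ huC hudecay hA hB hK hδ hδA
  have htrunc := fourier_truncation ψ K hu
  have htail := fourier_sub_truncation ψ K hu
  set uK := (Set.Icc (-(K : ℝ)) K).indicator u with huK
  have huKm : Measurable uK := hum.indicator measurableSet_Icc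
  have huKC : ∀ x, ‖uK x‖ ≤ C := fun x => (norm_indicator_le_norm_self u x).trans (huC x)
  have huK0 : ∀ x, (K : ℝ) < |x| → uK x = 0 := fun x hx =>
    Set.indicator_of_notMem (fun h : x ∈ Set.Icc (-(K : ℝ)) K => not_le.2 hx (abs_le.2 h)) u
  have hsymbol := ae_dualSymbol_eq ha0 b N _ htrunc (hbounds.mono fun γ h => h.2.1)
  have hmm : Measurable (dualMultiplier a (b / N) δ uK) := measurable_dualMultiplier huKm
  have hmC := norm_dualMultiplier_mul_le (a := a) hb'.le hδ huKC
  have hmemLp : MemLp (dualSymbol a b N (truncation ψ K)) 2 volume := by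
    have huK2 : MemLp uK 2 volume := (Lp.memLp _).ae_eq htrunc
    refine MemLp.ae_eq hsymbol.symm (huK2.of_le_mul (c := b / N / δ)
      ((Complex.measurable_ofReal.comp hmm).mul huKm).aestronglyMeasurable
      (ae_of_all _ fun x => ?_))
    rw [norm_mul, Complex.norm_real, Real.norm_of_nonneg (dualMultiplier_nonneg hb'.le hδ x)]
    exact mul_le_mul_of_nonneg_right (dualMultiplier_le hb'.le hδ x) (norm_nonneg _)
  refine ⟨?_, hmemLp, ?_⟩
  · filter_upwards [hbounds, ae_calderonSum_eq ha0 _ htrunc, ae_comp_zpow_mul_eq ha0 _ htrunc]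
      with γ h1 h2 h3
    simp only [h3, h2]
    exact ⟨h1.1, hδ.trans_le h1.2.1⟩
  intro g gt
  have hdual : (𝓕 (dualGenerator hmemLp) : L2) =ᵐ[volume]
      fun x => (dualMultiplier a (b / N) δ uK x : ℂ) * uK x := by
    rw [dualGenerator, FourierTransform.fourier_fourierInv_eq]
    exact hmemLp.coeFn_toLp.trans hsymbol
  have hBK := BesselBound.of_bandlimited ha0 hb' (truncation ψ K) huKm htrunc huKC hκ huK0
    (hbounds.mono fun γ h => h.2.2)
  have hBt : BesselBound gt (1 / (b / N) * (b / N * (b / N / δ))) :=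
    BesselBound.of_bandlimited ha0 hb' (dualGenerator hmemLp)
      ((Complex.measurable_ofReal.comp hmm).mul huKm) hdual hmC hκ
      (fun x hx => by simp [huK0 x hx])
      (hbounds.mono fun γ h => tsum_enorm_dualMultiplier_mul_sq_le ha0 hb'.le hδ h.1 h.2.1)
  have hBR := (BesselBound.of_tail ha hb' (ψ - truncation ψ K)
    (hum.indicator (measurableSet_lt_abs K)) htail hC.le hσ hK0 hκ.le
    (isTail_indicator hudecay hK0)).mono
    (mul_le_mul_of_nonneg_left (tail_bound_le_errorBound ha hb hσ hK) (by positivity))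
  have hg : g = fun p => waveletSystem ha0 (b / N) (truncation ψ K) p +
      waveletSystem ha0 (b / N) (ψ - truncation ψ K) p := by
    funext p
    rw [← waveletSystem_add, add_sub_cancel]
  have hBK0 : 0 ≤ 1 / (b / N) * (b * B) := by positivity
  have hBR0 : 0 ≤ 1 / (b / N) * (errorBound a b C σ K ^ 2 / 2) := by positivity
  have hBt0 : 0 ≤ 1 / (b / N) * (b / N * (b / N / δ)) := by positivity
  have hgB : IsBessel g := by
    rw [hg]
    exact (hBK.add hBK0 hBR0 hBR).isBessel
  have hconst : Real.sqrt (1 / (b / N) * (errorBound a b C σ K ^ 2 / 2) *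
      (1 / (b / N) * (b / N * (b / N / δ)))) ≤
      errorBound a b C σ K / (Real.sqrt (2 * b * A) - errorBound a b C σ K) := by
    refine le_of_eq_of_le ?_ (sqrt_div_sub_le hε0 hε)
    have : Real.sqrt (2 * b * A) ^ 2 / 2 - errorBound a b C σ K ^ 2 / 2 = δ := by
      rw [hs2]
      linarith
    rw [this]
    congr 1
    have hb'' := hb'.ne'
    set β := b / N
    field_simp
  have hmain : ∀ f : L2, Summable (expansionTerm g gt f) ∧
      ‖f - ∑' p, expansionTerm g gt f p‖ ≤ errorBound a b C σ K /
        (Real.sqrt (2 * b * A) - errorBound a b C σ K) * ‖f‖ := by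
    intro f
    have hd := tsum_expansionTerm_eq_self ha0 hb' (truncation ψ K) (dualGenerator hmemLp) huKm hmm
      (dualMultiplier_nonneg hb'.le hδ) htrunc hdual huKC hmC hκ huK0
      (hbounds.mono fun γ h => hasSum_dualMultiplier ha0 hδ h.1 h.2.1) hBK0 hBK hBt f
    rw [hg]
    have h := norm_sub_tsum_expansionTerm_le hBK0 hBR0 hBt0 hBK hBR hBt f hd
    exact ⟨h.1, h.2.trans (mul_le_mul_of_nonneg_right hconst (norm_nonneg f))⟩
  exact ⟨hgB, hBt.isBessel, hmain, fun hlt => ⟨hgB, hBt.isBessel, _, hlt, hmain⟩⟩
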